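/- A halfspace on $\mathbb{R}^d$ is a function $f:\mathbb{R}^d\to\{\pm1\}$ of the form $f(\mathbf x)=\mathrm{sign}(\langle \mathbf w,\mathbf x\rangle+\theta)$ with $\mathbf w\in\mathbb{R}^d$, $\theta\in\mathbb{R}$, where $\mathrm{sign}(u)=1$ if $u\ge 0$ and $\mathrm{sign}(u)=-1$ otherwise. For a distribution $\mathcal D$ on $\mathbb{R}^d\times\{\pm1\}$ let $\mathrm{OPT}(\mathcal D)=\inf_f \Pr_{(\mathbf x,y)\sim\mathcal D}[f(\mathbf x)\ne y]$, the infimum being over all halfspaces $f$. A statistical query is a function $q:\mathbb{R}^d\times[-1,1]\to[-1,1]$. A $\mathrm{STAT}(\tau)$ oracle for $\mathcal D$ answers every query $q$ by a value $v$ with $|v-\mathbb{E}_{(\mathbf x,y)\sim\mathcal D}[q(\mathbf x,y)]|\le\tau$. An SQ algorithm (possibly randomized) adaptively asks finitely many statistical queries, has no other access to $\mathcal D$, and outputs a hypothesis $h:\mathbb{R}^d\to\{\pm1\}$. It agnostically learns halfspaces under Gaussian marginals within additive error $\epsilon$ using $\mathrm{STAT}(\tau)$ if, for every distribution $\mathcal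 D$ on $\mathbb{R}^d\times\{\pm1\}$ whose marginal on $\mathbb{R}^d$ is $\mathcal N(\mathbf 0,\mathbf I)$ and every $\mathrm{STAT}(\tau)$ oracle for $\mathcal D$, with probability at least $2/3$ over its randomness it outputs $h$ with $\Pr_{(\mathbf x,y)\sim\mathcal D}[h(\mathbf x)\neq y]\le\mathrm{OPT}(\mathcal D)+\epsilon$. Theorem. There is a constant $c>0$ such that the following holds for every integer $d\ge1$ and every $\epsilon$ with $d^{-c}\le\epsilon<1/2$. Any SQ algorithm that agnostically learns halfspaces on $\mathbb{R}^d$ under Gaussian marginals within additive error $\epsilon$ using $\mathrm{STAT}(d^{-c/\epsilon})$ needs at least $d^{c/\epsilon}$ queries in the worst case: there are a distribution $\mathcal D$ as above and a $\mathrm{STAT}(d^{-c/\epsilon})$ oracle for $\mathcal D$ with which the algorithm asks at least $d^{c/\epsilon}$ queries with positive probability. -/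

import Mathlib

open MeasureTheory ProbabilityTheory

/-- Labelled examples `(x, y)` with `x ∈ ℝ^d` and `y ∈ [-1, 1]`. -/
abbrev LabeledExample (d : ℕ) : Type :=
  EuclideanSpace ℝ (Fin d) × Set.Icc (-1 : ℝ) 1

/-- A joint distribution of labelled examples on `ℝ^d × {±1}` whose marginal on `ℝ^d` is the
standard Gaussian. Nothing else is assumed about the labels. (Such a measure has mass one, because
its marginal has.) -/
structure IsGaussianInstance {d : ℕ} (D : Measure (LabeledExample d)) : Prop where
  marginal : D.map Prod.fst = stdGaussian (EuclideanSpace ℝ (Fin d))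
  labels : ∀ᵐ p ∂D, (p.2 : ℝ) = 1 ∨ (p.2 : ℝ) = -1

/-- A statistical query: a (measurable) function `q : ℝ^d × [-1, 1] → [-1, 1]`. -/
structure StatQuery (d : ℕ) where
  toFun : LabeledExample d → ℝ
  measurable : Measurable toFun
  mem_Icc : ∀ p, toFun p ∈ Set.Icc (-1 : ℝ) 1

/-- A hypothesis: a (measurable) function `h : ℝ^d → {±1}`. -/
structure Hypothesis (d : ℕ) where
  toFun : EuclideanSpace ℝ (Fin d) → ℝ
  measurable : Measurable toFun
  eq_one_or : ∀ x, toFun x = 1 ∨ toFun x = -1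

/-- The oracles `STAT(τ)` for the distribution `D`: every query `q` is answered by a value within
`τ` of the expectation of `q(x, y)` for `(x, y) ∼ D`. -/
def STAT {d : ℕ} (D : Measure (LabeledExample d)) (τ : ℝ) : Set (StatQuery d → ℝ) :=
  {O | ∀ q, |O q - ∫ p, q.toFun p ∂D| ≤ τ}

/-- A deterministic SQ algorithm: it either stops and outputs a hypothesis, or asks a statistical
query and continues in a way that may depend on the answer. -/
inductive SQAlgorithm (d : ℕ) : Type
  | output (h : Hypothesis d) : SQAlgorithm d
  | query (q : StatQuery d) (next : ℝ → SQAlgorithm d) : SQAlgorithm d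

namespace SQAlgorithm

/-- The hypothesis that the algorithm outputs when its queries are answered by `O`. -/
def run {d : ℕ} (O : StatQuery d → ℝ) : SQAlgorithm d → Hypothesis d
  | output h => h
  | query q next => run O (next (O q))

/-- The number of queries that the algorithm asks when they are answered by `O`. -/
def numQueries {d : ℕ} (O : StatQuery d → ℝ) : SQAlgorithm d → ℕ
  | output _ => 0
  | query q next => numQueries O (next (O q)) + 1

end SQAlgorithm

/-- The 0-1 error `Pr_{(x, y) ∼ D} [f(x) ≠ y]`. -/
noncomputable def zeroOneError {d : ℕ} (D : Measure (LabeledExample d))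
    (f : EuclideanSpace ℝ (Fin d) → ℝ) : ℝ :=
  D.real {p | f p.1 ≠ (p.2 : ℝ)}

/-- The halfspace `x ↦ sign (⟨w, x⟩ + θ)`, where `sign u = 1` if `u ≥ 0` and `-1` otherwise. -/
noncomputable def halfspace {d : ℕ} (w : EuclideanSpace ℝ (Fin d)) (θ : ℝ)
    (x : EuclideanSpace ℝ (Fin d)) : ℝ :=
  if 0 ≤ inner ℝ w x + θ then 1 else -1

/-- `OPT`: the infimum of the 0-1 error over all halfspaces. -/
noncomputable def optHalfspaceError {d : ℕ} (D : Measure (LabeledExample d)) : ℝ :=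
  ⨅ a : EuclideanSpace ℝ (Fin d) × ℝ, zeroOneError D (halfspace a.1 a.2)

/-- The randomized SQ algorithm `A`, with random seed `ω ∼ μ`, agnostically learns halfspaces
under standard Gaussian marginals within additive error `ε` from `STAT(τ)`: for every instance and
every valid oracle, it outputs a hypothesis of 0-1 error at most `OPT + ε` with probability at
least `2/3`. (The failure event is measured by the outer measure of `μ`.) -/
def AgnosticallyLearnsHalfspaces {d : ℕ} {Ω : Type*} [MeasurableSpace Ω] (μ : Measure Ω)
    (A : Ω → SQAlgorithm d) (ε τ : ℝ) : Prop :=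
  ∀ D : Measure (LabeledExample d), IsGaussianInstance D → ∀ O ∈ STAT D τ,
    μ {ω | ¬ zeroOneError D ((A ω).run O).toFun ≤ optHalfspaceError D + ε} ≤ 1 / 3

/-! Label a Gaussian vector `x` by `f ⟨v, x⟩`, with `f` a ±1-valued function on the line and `v` a
hidden unit vector. If `f` is orthogonal under the Gaussian to all polynomials of degree below `m`,
labelings for different directions are nearly uncorrelated, so queries hardly reveal `v`. If `f`
also correlates with a threshold, OPT stays visibly below 1/2.

`exists_moment_matching_sign` achieves both. Take the sign of a monic polynomial of degree `m` with
least L¹ norm: stationarity of the norm is the orthogonality. Its sign pattern has at most `m`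
changes, hence is a constant plus at most `m` thresholds with coefficients in [-1, 1]. Pairing it
with itself gives 1, so some threshold carries at least 1/m, and OPT is at most 1/2 - 1/(2m). Choose
`m` just below 1/(2ε).

Two projections with small inner product ρ ≥ 0 have a joint Gaussian density whose Taylor terms of
order below `m` are invisible to `f ⊗ f`; this leaves a correlation of at most 4(4ρ)^m
(`abs_integral_inner_mul_inner_le`). Reed–Solomon codes supply p^m directions with ρ ≤ m/p, where p
is about √d. By `card_mul_le_one_of_correlated`, each query then separates only few directions from
uniformly random labels.

Suppose few queries are asked when labels are uniform. For most directions the oracle may answer as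
if labels were uniform, so the output depends neither on the direction nor on a global sign of the
labels. The errors for labels `g` and `-g` add up to 1, yet success on both needs both below 1/2.
Counting these failures contradicts success probability 2/3 (`exists_many_queries`). -/

/-! ### Products of threshold functions. -/

/-- The threshold function at `t` with values `±1`. -/
noncomputable def stepSign (t z : ℝ) : ℝ := if t ≤ z then 1 else -1

lemma stepSign_eq_one_or (t z : ℝ) : stepSign t z = 1 ∨ stepSign t z = -1 := by
  unfold stepSign; split_ifs <;> simp

lemma measurable_stepSign (t : ℝ) : Measurable (stepSign t) :=
  Measurable.ite measurableSet_Ici measurable_const measurable_const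

lemma eq_one_or_neg_one_prod {ι : Type*} (s : Finset ι) (f : ι → ℝ)
    (h : ∀ i ∈ s, f i = 1 ∨ f i = -1) : ∏ i ∈ s, f i = 1 ∨ ∏ i ∈ s, f i = -1 := by
  refine Finset.prod_induction f (fun x => x = 1 ∨ x = -1) ?_ (Or.inl rfl) h
  rintro a b (rfl | rfl) (rfl | rfl) <;> simp

/-- A product of threshold functions is a constant plus a combination of the same threshold
functions with coefficients in `[-1, 1]`. -/
lemma exists_prod_stepSign_eq_sum (S : Finset ℝ) :
    ∃ (c : ℝ) (σ : ℝ → ℝ), (∀ t, |σ t| ≤ 1) ∧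
      ∀ z, ∏ t ∈ S, stepSign t z = c + ∑ t ∈ S, σ t * stepSign t z := by
  induction S using Finset.induction_on_max with
  | empty => exact ⟨1, 0, by simp, by simp⟩
  | insert a s ha ih =>
    obtain ⟨c, σ, hσ, h⟩ := ih
    have has : a ∉ s := fun h => lt_irrefl _ (ha a h)
    -- With `a` the largest threshold and `P` the product over `s`, the product over `insert a s` is
    -- `1 - P + stepSign a`: right of `a` we have `P = 1`, left of `a` the new factor is -1. So old
    -- coefficients only change sign and never grow.
    refine ⟨1 - c, fun t => if t = a then 1 else -σ t, fun t => ?_, fun z => ?_⟩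
    · dsimp only; split_ifs
      · simp
      · simpa using hσ t
    · rw [Finset.prod_insert has, Finset.sum_insert has]
      have h1 : ∑ t ∈ s, (if t = a then 1 else -σ t) * stepSign t z
          = -∑ t ∈ s, σ t * stepSign t z := by
        rw [← Finset.sum_neg_distrib]
        refine Finset.sum_congr rfl fun t ht => ?_
        rw [if_neg (ne_of_mem_of_not_mem ht has)]; ring
      rw [h1]
      have h2 : stepSign a z * ∏ t ∈ s, stepSign t z = -∏ t ∈ s, stepSign t z + 1 + stepSign a z := by
        by_cases hz : a ≤ z
        · have : ∏ t ∈ s, stepSign t z = 1 :=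
            Finset.prod_eq_one fun t ht => if_pos ((ha t ht).le.trans hz)
          rw [this]; simp
        · have : stepSign a z = -1 := if_neg hz
          rw [this]; ring
      rw [h2, h z]; simp only [if_true]; ring

lemma integrable_of_eq_one_or {α : Type*} [MeasurableSpace α] {μ : Measure α} [IsFiniteMeasure μ]
    {f : α → ℝ} (hf : Measurable f) (h : ∀ z, f z = 1 ∨ f z = -1) : Integrable f μ := by
  refine Integrable.of_bound (C := 1) hf.aestronglyMeasurable (ae_of_all _ fun z => ?_)
  rcases h z with h | h <;> simp [h]

/-- A centred product of at most `m` threshold functions has correlation at least `1 / m` with one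
of them. -/
lemma exists_stepSign_correlation (μ : Measure ℝ) [IsProbabilityMeasure μ] (S : Finset ℝ) {m : ℕ}
    (hm : 0 < m) (hS : S.card ≤ m) (h0 : ∫ z, ∏ t ∈ S, stepSign t z ∂μ = 0) :
    ∃ t, 1 / (m : ℝ) ≤ |∫ z, (∏ t ∈ S, stepSign t z) * stepSign t z ∂μ| := by
  obtain ⟨c, σ, hσ, h⟩ := exists_prod_stepSign_eq_sum S
  set F : ℝ → ℝ := fun z => ∏ t ∈ S, stepSign t z with hF
  have hFm : Measurable F := Finset.measurable_fun_prod _ fun t _ => measurable_stepSign t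
  have hF1 : ∀ z, F z = 1 ∨ F z = -1 := fun z =>
    eq_one_or_neg_one_prod S _ fun t _ => stepSign_eq_one_or t z
  have hFt : ∀ t, Integrable (fun z => F z * stepSign t z) μ := fun t =>
    integrable_of_eq_one_or (hFm.mul (measurable_stepSign t)) fun z => by
      rcases hF1 z with h | h <;> rcases stepSign_eq_one_or t z with h' | h' <;> simp [h, h']
  -- Expand one factor of `F * F = 1`; the constant term disappears because `F` is centred.
  have hsum : 1 = ∑ t ∈ S, σ t * ∫ z, F z * stepSign t z ∂μ := by
    have h1 : ∀ z, (1 : ℝ) = c * F z + ∑ t ∈ S, σ t * (F z * stepSign t z) := by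
      intro z
      have h2 : F z * F z = 1 := by rcases hF1 z with h | h <;> simp [h]
      calc (1 : ℝ) = F z * (c + ∑ t ∈ S, σ t * stepSign t z) := by rw [← h z]; exact h2.symm
        _ = _ := by rw [mul_add, Finset.mul_sum]; congr 1
                    · ring
                    · exact Finset.sum_congr rfl fun t _ => by ring
    calc (1 : ℝ) = ∫ z, (1 : ℝ) ∂μ := by simp
      _ = ∫ z, (c * F z + ∑ t ∈ S, σ t * (F z * stepSign t z)) ∂μ := by
          congr 1; ext z; exact h1 z
      _ = _ := by
        rw [integral_add ((integrable_of_eq_one_or hFm hF1).const_mul c)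
          (integrable_finsetSum _ fun t _ => (hFt t).const_mul _), integral_const_mul, h0,
          integral_finsetSum _ fun t _ => (hFt t).const_mul _]
        simp [integral_const_mul]
  by_contra! hcon
  have hlt : (1 : ℝ) < 1 := by
    have hSne : S.Nonempty := by
      rw [Finset.nonempty_iff_ne_empty]; rintro rfl; simp at hsum
    calc (1 : ℝ) = ∑ t ∈ S, σ t * ∫ z, F z * stepSign t z ∂μ := hsum
      _ < ∑ t ∈ S, 1 / (m : ℝ) := by
        refine Finset.sum_lt_sum_of_nonempty hSne fun t _ => ?_
        calc _ ≤ |σ t * ∫ z, F z * stepSign t z ∂μ| := le_abs_self _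
          _ ≤ 1 * |∫ z, F z * stepSign t z ∂μ| := by
            rw [abs_mul]; exact mul_le_mul_of_nonneg_right (hσ t) (abs_nonneg _)
          _ < _ := by rw [one_mul]; exact hcon t
      _ = S.card / (m : ℝ) := by simp [div_eq_mul_inv]
      _ ≤ 1 := by
        rw [div_le_one (by positivity)]; exact_mod_cast hS
  exact lt_irrefl _ hlt

/-! ### Sign patterns of real polynomials. -/

lemma Polynomial.eval_pos_or_neg_of_roots_eq_zero {q : Polynomial ℝ} (hq : q ≠ 0)
    (h : q.roots = 0) : (∀ z, 0 < q.eval z) ∨ ∀ z, q.eval z < 0 := by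
  by_contra! hcon
  obtain ⟨⟨a, ha⟩, b, hb⟩ := hcon
  obtain ⟨z, hz⟩ := mem_range_of_exists_le_of_exists_ge q.continuous ⟨a, ha⟩ ⟨b, hb⟩
  have : z ∈ q.roots := (Polynomial.mem_roots hq).2 hz
  simp [h] at this

/-- Off its roots, a nonzero real polynomial has, up to a constant, the sign of a product of
threshold functions. -/
lemma Polynomial.exists_sign_eval_eq_prod_stepSign {P : Polynomial ℝ} (hP : P ≠ 0) :
    ∃ (S : Finset ℝ) (s : ℝ), S.card ≤ P.natDegree ∧ (s = 1 ∨ s = -1) ∧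
      ∀ z, P.eval z ≠ 0 → ∏ t ∈ S, stepSign t z = s * Real.sign (P.eval z) := by
  classical
  obtain ⟨q, hPq, hdeg, hq⟩ := P.exists_prod_multiset_X_sub_C_mul
  have hq0 : q ≠ 0 := by rintro rfl; simp at hPq; exact hP hPq.symm
  obtain ⟨s, hs, hsq⟩ : ∃ s : ℝ, (s = 1 ∨ s = -1) ∧ ∀ z, Real.sign (q.eval z) = s := by
    rcases Polynomial.eval_pos_or_neg_of_roots_eq_zero hq0 hq with h | h
    · exact ⟨1, Or.inl rfl, fun z => Real.sign_of_pos (h z)⟩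
    · exact ⟨-1, Or.inr rfl, fun z => Real.sign_of_neg (h z)⟩
  -- Only roots of odd multiplicity change the sign.
  refine ⟨P.roots.toFinset.filter fun t => Odd (P.roots.count t), s, ?_, hs, fun z hz => ?_⟩
  · calc _ ≤ P.roots.toFinset.card := Finset.card_filter_le _ _
      _ ≤ Multiset.card P.roots := Multiset.toFinset_card_le _
      _ ≤ _ := P.card_roots'
  · have h1 : Real.sign (P.eval z) = (P.roots.map fun t => stepSign t z).prod * s := by
      conv_lhs => rw [← hPq]
      have hne : ∀ t ∈ P.roots, z ≠ t := fun t ht h =>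
        hz (h ▸ (Polynomial.mem_roots hP).1 ht)
      have hmul : ∀ a b : ℝ, Real.sign (a * b) = Real.sign a * Real.sign b := by
        intro a b
        rcases lt_trichotomy a 0 with ha | ha | ha <;> rcases lt_trichotomy b 0 with hb | hb | hb <;>
          simp [ha, hb, Real.sign_of_pos, Real.sign_of_neg, mul_pos_of_neg_of_neg, mul_neg_of_neg_of_pos,
            mul_neg_of_pos_of_neg]
      rw [Polynomial.eval_mul, hmul, hsq]
      congr 1
      generalize P.roots = R at hne
      induction R using Multiset.induction_on with
      | empty => simp
      | cons a R ih =>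
        simp only [Multiset.map_cons, Multiset.prod_cons, Polynomial.eval_mul, hmul]
        rw [ih fun t ht => hne t (Multiset.mem_cons_of_mem ht)]
        congr 1
        have := hne a (Multiset.mem_cons_self a R)
        rcases lt_or_gt_of_ne this with h | h
        · rw [stepSign, if_neg (not_le.2 h)]; exact Real.sign_of_neg (by simpa using h)
        · rw [stepSign, if_pos h.le]; exact Real.sign_of_pos (by simpa using h)
    rw [h1, Finset.prod_multiset_map_count, Finset.prod_filter]
    have hss : s * s = 1 := by rcases hs with h | h <;> simp [h]
    rw [mul_comm _ s, ← mul_assoc, hss, one_mul]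
    refine Finset.prod_congr rfl fun t _ => ?_
    split_ifs with ho
    · obtain ⟨k, hk⟩ := ho
      rw [hk]; rcases stepSign_eq_one_or t z with h | h <;> simp [h, pow_succ, pow_mul]
    · rw [Nat.not_odd_iff_even] at ho
      obtain ⟨k, hk⟩ := ho
      rw [hk]; rcases stepSign_eq_one_or t z with h | h <;> simp [h, ← two_mul, pow_mul]

/-! ### L¹-minimal polynomials and orthogonality of their signs. -/

lemma Polynomial.integrable_eval {μ : Measure ℝ} (hμ : ∀ k : ℕ, Integrable (fun z => z ^ k) μ)
    (P : Polynomial ℝ) : Integrable (fun z => P.eval z) μ := by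
  simp only [Polynomial.eval_eq_sum_range]
  exact integrable_finsetSum _ fun k _ => (hμ k).const_mul _

/-- Polynomials as elements of `L¹(μ)`. -/
noncomputable def polynomialToL1 {μ : Measure ℝ} (hμ : ∀ k : ℕ, Integrable (fun z => z ^ k) μ) :
    Polynomial ℝ →ₗ[ℝ] Lp ℝ 1 μ where
  toFun P := (memLp_one_iff_integrable.2 (P.integrable_eval hμ)).toLp _
  map_add' P Q := by
    rw [← MemLp.toLp_add]; congr 1; ext z; simp
  map_smul' c P := by
    rw [RingHom.id_apply, ← MemLp.toLp_const_smul]; congr 1; ext z; simp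

lemma norm_polynomialToL1 {μ : Measure ℝ} (hμ : ∀ k : ℕ, Integrable (fun z => z ^ k) μ)
    (P : Polynomial ℝ) : ‖polynomialToL1 hμ P‖ = ∫ z, |P.eval z| ∂μ := by
  rw [L1.norm_eq_integral_norm]
  refine integral_congr_ae ?_
  filter_upwards [(memLp_one_iff_integrable.2 (P.integrable_eval hμ)).coeFn_toLp] with z hz
  exact congrArg norm hz

/-- Among the monic polynomials of degree `m` there is one of minimal `L¹(μ)` norm. -/
lemma Polynomial.exists_l1_minimal {μ : Measure ℝ} (hμ : ∀ k : ℕ, Integrable (fun z => z ^ k) μ)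
    (m : ℕ) : ∃ P : Polynomial ℝ, P.Monic ∧ P.natDegree = m ∧
      ∀ Q : Polynomial ℝ, Q.degree < m → ∫ z, |P.eval z| ∂μ ≤ ∫ z, |(P + Q).eval z| ∂μ := by
  set L := polynomialToL1 hμ with hL
  set V := (Polynomial.degreeLT ℝ m).map L
  have : FiniteDimensional ℝ (Polynomial.degreeLT ℝ m) :=
    Module.Finite.equiv (Polynomial.degreeLTEquiv ℝ m).symm
  have : FiniteDimensional ℝ V := Module.Finite.map _ _
  have : ProperSpace V := FiniteDimensional.proper ℝ V
  -- The norm is continuous and coercive on the finite-dimensional, hence proper, space of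
  -- lower-order corrections, so a minimum is attained.
  obtain ⟨⟨_, q, hq, rfl⟩, hv⟩ := Continuous.exists_forall_le (β := V)
    (f := fun v : V => ‖L (Polynomial.X ^ m) + (v : Lp ℝ 1 μ)‖) (by fun_prop) (by
      refine Filter.tendsto_atTop_mono (f := fun v : V => ‖v‖ - ‖L (Polynomial.X ^ m)‖) (fun v => ?_)
        (Filter.tendsto_atTop_add_const_right _ _ (tendsto_norm_cocompact_atTop))
      have := norm_sub_le (L (Polynomial.X ^ m) + (v : Lp ℝ 1 μ)) (L (Polynomial.X ^ m))
      rw [add_sub_cancel_left] at this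
      rw [← Submodule.coe_norm v] at this
      linarith)
  have hq' : q.degree < m := Polynomial.mem_degreeLT.1 hq
  refine ⟨Polynomial.X ^ m + q, Polynomial.monic_X_pow_add hq', ?_, fun Q hQ => ?_⟩
  · rw [Polynomial.natDegree_add_eq_left_of_degree_lt, Polynomial.natDegree_X_pow]
    rwa [Polynomial.degree_X_pow]
  · have := hv ⟨L (q + Q), q + Q, add_mem hq (Polynomial.mem_degreeLT.2 hQ), rfl⟩
    simp only [← map_add] at this
    rw [hL, norm_polynomialToL1, norm_polynomialToL1, ← add_assoc] at this
    exact this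

lemma hasDerivAt_abs_add_mul {a b : ℝ} (ha : a ≠ 0) :
    HasDerivAt (fun t : ℝ => |a + t * b|) (Real.sign a * b) 0 := by
  have h1 : HasDerivAt (fun t : ℝ => a + t * b) b 0 := by
    simpa using ((hasDerivAt_id (0 : ℝ)).mul_const b).const_add a
  have h2 : HasDerivAt (fun x : ℝ => |x|) (Real.sign a) (a + 0 * b) := by
    rw [zero_mul, add_zero]
    rcases lt_or_gt_of_ne ha with h | h
    · rw [Real.sign_of_neg h]; exact hasDerivAt_abs_neg h
    · rw [Real.sign_of_pos h]; exact hasDerivAt_abs_pos h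
  exact h2.comp 0 h1

lemma measurable_real_sign : Measurable Real.sign :=
  Measurable.ite measurableSet_Iio measurable_const
    (Measurable.ite measurableSet_Ioi measurable_const measurable_const)

lemma Polynomial.ae_eval_ne_zero {μ : Measure ℝ} [NullSingletonClass μ] {P : Polynomial ℝ} (hP : P ≠ 0) :
    ∀ᵐ z ∂μ, P.eval z ≠ 0 := by
  have : (P.rootSet ℝ).Countable := (P.rootSet_finite ℝ).countable
  refine (measure_eq_zero_iff_ae_notMem.1 (this.measure_zero μ)).mono fun z hz h => hz ?_
  rw [Polynomial.mem_rootSet]; exact ⟨hP, by simpa using h⟩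

/-- For a measure without atoms that has all moments there is a monic polynomial of degree `m`
whose sign is orthogonal to all polynomials of degree less than `m`. -/
lemma Polynomial.exists_sign_orthogonal {μ : Measure ℝ} [NullSingletonClass μ]
    (hμ : ∀ k : ℕ, Integrable (fun z => z ^ k) μ) (m : ℕ) :
    ∃ P : Polynomial ℝ, P.Monic ∧ P.natDegree = m ∧
      ∀ k < m, ∫ z, Real.sign (P.eval z) * z ^ k ∂μ = 0 := by
  obtain ⟨P, hmonic, hdeg, hmin⟩ := Polynomial.exists_l1_minimal hμ m
  refine ⟨P, hmonic, hdeg, fun k hk => ?_⟩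
  have hint : ∀ t : ℝ, Integrable (fun z => P.eval z + t * z ^ k) μ := fun t =>
    (P.integrable_eval hμ).add ((hμ k).const_mul t)
  -- The derivative at 0 of the L¹ norm along the perturbation `t * z ^ k` is the moment in
  -- question; minimality makes it vanish.
  have hd := (hasDerivAt_integral_of_dominated_loc_of_lip (μ := μ) (𝕜 := ℝ) (x₀ := 0)
    (s := Set.univ) (F := fun t z => |P.eval z + t * z ^ k|)
    (F' := fun z => Real.sign (P.eval z) * z ^ k) (bound := fun z => |z ^ k|)
    Filter.univ_mem (Filter.Eventually.of_forall fun t => (hint t).abs.aestronglyMeasurable)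
    (hint 0).abs
    ((measurable_real_sign.comp P.continuous.measurable).mul
      (measurable_id.pow_const k)).aestronglyMeasurable
    (ae_of_all _ fun z => ?_) (hμ k).abs ?_).2
  · refine IsLocalMin.hasDerivAt_eq_zero (Filter.Eventually.of_forall fun t => ?_) hd
    have := hmin (Polynomial.C t * Polynomial.X ^ k)
      ((Polynomial.degree_C_mul_X_pow_le k t).trans_lt (by exact_mod_cast hk))
    simpa using this
  · refine LipschitzOnWith.of_dist_le_mul fun s _ t _ => ?_
    rw [Real.dist_eq, Real.dist_eq, Real.coe_nnabs, abs_abs]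
    refine (abs_abs_sub_abs_le_abs_sub _ _).trans (le_of_eq ?_)
    rw [← abs_mul]; congr 1; ring
  · filter_upwards [Polynomial.ae_eval_ne_zero hmonic.ne_zero] with z hz
    exact hasDerivAt_abs_add_mul hz

/-- For every `m ≥ 1` there is a `±1`-valued function that is orthogonal to all polynomials of
degree less than `m` and has correlation at least `1 / m` with a threshold function. -/
theorem exists_moment_matching_sign {μ : Measure ℝ} [IsProbabilityMeasure μ] [NullSingletonClass μ]
    (hμ : ∀ k : ℕ, Integrable (fun z => z ^ k) μ) {m : ℕ} (hm : 0 < m) :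
    ∃ f : ℝ → ℝ, Measurable f ∧ (∀ z, f z = 1 ∨ f z = -1) ∧
      (∀ k < m, ∫ z, f z * z ^ k ∂μ = 0) ∧
      ∃ t, 1 / (m : ℝ) ≤ |∫ z, f z * stepSign t z ∂μ| := by
  obtain ⟨P, hmonic, hdeg, horth⟩ := Polynomial.exists_sign_orthogonal hμ m
  obtain ⟨S, s, hS, -, hs⟩ := Polynomial.exists_sign_eval_eq_prod_stepSign hmonic.ne_zero
  have hmom : ∀ k < m, ∫ z, (∏ t ∈ S, stepSign t z) * z ^ k ∂μ = 0 := fun k hk => by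
    have : ∫ z, (∏ t ∈ S, stepSign t z) * z ^ k ∂μ
        = ∫ z, s * (Real.sign (P.eval z) * z ^ k) ∂μ := by
      refine integral_congr_ae ?_
      filter_upwards [Polynomial.ae_eval_ne_zero hmonic.ne_zero] with z hz
      rw [hs z hz, mul_assoc]
    rw [this, integral_const_mul, horth k hk, mul_zero]
  exact ⟨_, Finset.measurable_fun_prod _ fun t _ => measurable_stepSign t,
    fun z => eq_one_or_neg_one_prod S _ fun t _ => stepSign_eq_one_or t z, hmom,
    exists_stepSign_correlation μ S hm (hS.trans hdeg.le) (by simpa using hmom 0 hm)⟩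

/-! ### Vanishing moments against an exponential kernel. -/

/-- If `|s| ≤ δ u` with `δ ≤ 1`, the Taylor remainder of order `m` of `exp s` is at most
`δ ^ m * exp u`. -/
lemma abs_exp_sub_taylor_le {s δ u : ℝ} (hδ0 : 0 ≤ δ) (hδ1 : δ ≤ 1) (hu : 0 ≤ u) (hs : |s| ≤ δ * u)
    (m : ℕ) :
    |Real.exp s - ∑ k ∈ Finset.range m, s ^ k / (k.factorial : ℝ)| ≤ δ ^ m * Real.exp u := by
  have hsum : ∀ x : ℝ, HasSum (fun k : ℕ => x ^ k / (k.factorial : ℝ)) (Real.exp x) := fun x => by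
    rw [Real.exp_eq_exp_ℝ]; exact NormedSpace.expSeries_div_hasSum_exp x
  -- Compare the two exponential tails termwise: each term of order at least `m` gains a factor `δ ^
  -- m`.
  have h1 := (hasSum_nat_add_iff' m).2 (hsum s)
  have h2 := ((hasSum_nat_add_iff' m).2 (hsum u)).mul_left (δ ^ m)
  refine (h1.norm_le_of_bounded h2 fun k => ?_).trans ?_
  · rw [Real.norm_eq_abs, abs_div, abs_pow, Nat.abs_cast, ← mul_div_assoc]
    gcongr
    calc |s| ^ (k + m) ≤ (δ * u) ^ (k + m) := by gcongr
      _ = δ ^ k * (δ ^ m * u ^ (k + m)) := by ring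
      _ ≤ 1 * (δ ^ m * u ^ (k + m)) := by gcongr; exact pow_le_one₀ hδ0 hδ1
      _ = _ := one_mul _
  · gcongr
    exact sub_le_self _ (Finset.sum_nonneg fun k _ => by positivity)

/-- If the first `m` moments of `f` vanish, then `f(x) f(y)` is orthogonal to the powers of order
less than `m` of a quadratic form in `x, y`. -/
lemma integral_mul_quadratic_pow_eq_zero {μ : Measure ℝ} [SFinite μ] {f : ℝ → ℝ} {m : ℕ}
    (hint : ∀ k : ℕ, Integrable (fun z => f z * z ^ k) μ)
    (hf : ∀ k < m, ∫ z, f z * z ^ k ∂μ = 0) (a b : ℝ) {k : ℕ} (hk : k < m) :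
    Integrable (fun p : ℝ × ℝ => f p.1 * f p.2 * (a * p.1 * p.2 - b * (p.1 ^ 2 + p.2 ^ 2)) ^ k)
      (μ.prod μ) ∧
    ∫ p : ℝ × ℝ, f p.1 * f p.2 * (a * p.1 * p.2 - b * (p.1 ^ 2 + p.2 ^ 2)) ^ k ∂μ.prod μ = 0 := by
  have hexp : ∀ p : ℝ × ℝ, f p.1 * f p.2 * (a * p.1 * p.2 - b * (p.1 ^ 2 + p.2 ^ 2)) ^ k =
      ∑ i ∈ Finset.range (k + 1), ∑ j ∈ Finset.range (k - i + 1),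
        ((-b) ^ i * (a ^ j * (-b) ^ (k - i - j) * ((k - i).choose j)) * (k.choose i)) *
        ((f p.1 * p.1 ^ (2 * i + j)) * (f p.2 * p.2 ^ (j + 2 * (k - i - j)))) := fun p => by
    have : a * p.1 * p.2 - b * (p.1 ^ 2 + p.2 ^ 2)
        = -b * p.1 ^ 2 + (a * p.1 * p.2 + -b * p.2 ^ 2) := by ring
    rw [this, add_pow, Finset.mul_sum]
    refine Finset.sum_congr rfl fun i _ => ?_
    rw [add_pow, Finset.mul_sum, Finset.sum_mul, Finset.mul_sum]
    refine Finset.sum_congr rfl fun j _ => ?_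
    ring
  have hterm : ∀ i j : ℕ, Integrable (fun p : ℝ × ℝ =>
      ((-b) ^ i * (a ^ j * (-b) ^ (k - i - j) * ((k - i).choose j)) * (k.choose i)) *
        ((f p.1 * p.1 ^ (2 * i + j)) * (f p.2 * p.2 ^ (j + 2 * (k - i - j))))) (μ.prod μ) :=
    fun i j => ((hint _).mul_prod (hint _)).const_mul _
  simp only [hexp]
  refine ⟨integrable_finsetSum _ fun i _ => integrable_finsetSum _ fun j _ => hterm i j, ?_⟩
  rw [integral_finsetSum _ fun i _ => integrable_finsetSum _ fun j _ => hterm i j]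
  refine Finset.sum_eq_zero fun i hi => ?_
  rw [integral_finsetSum _ fun j _ => hterm i j]
  refine Finset.sum_eq_zero fun j hj => ?_
  rw [Finset.mem_range] at hi hj
  rw [integral_const_mul, integral_prod_mul (fun x => f x * x ^ (2 * i + j))
    (fun y => f y * y ^ (j + 2 * (k - i - j)))]
  -- The two exponents add up to `2 * k < 2 * m`, so one of them is below `m`.
  rcases lt_or_ge (2 * i + j) m with h | h
  · rw [hf _ h]; simp
  · rw [hf (j + 2 * (k - i - j)) (by omega)]; simp

lemma gaussianPDFReal_mul_exp_quarter (z : ℝ) :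
    gaussianPDFReal 0 1 z * Real.exp (z ^ 2 / 4)
      = (Real.sqrt (2 * Real.pi))⁻¹ * Real.exp (-(1 / 4) * z ^ 2) := by
  simp only [gaussianPDFReal, NNReal.coe_one, mul_one, sub_zero]
  rw [mul_assoc, ← Real.exp_add]; congr 2; ring

/-- The weight that dominates the Taylor remainder. The rate 1/4 stays below the rate 1/2 of the
Gaussian density; the integral √2 per variable yields the factor 2 in `abs_integral_exp_kernel_le`.
-/
lemma integrable_exp_sq_quarter :
    Integrable (fun z : ℝ => Real.exp (z ^ 2 / 4)) (gaussianReal 0 1) := by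
  rw [gaussianReal_of_var_ne_zero _ one_ne_zero, integrable_withDensity_iff
    (measurable_gaussianPDF 0 1) (ae_of_all _ fun x => gaussianPDF_lt_top)]
  simp only [toReal_gaussianPDF]
  simp_rw [mul_comm (Real.exp _), gaussianPDFReal_mul_exp_quarter]
  exact (integrable_exp_neg_mul_sq (by norm_num)).const_mul _

lemma integral_exp_sq_quarter :
    ∫ z : ℝ, Real.exp (z ^ 2 / 4) ∂gaussianReal 0 1 = Real.sqrt 2 := by
  rw [integral_gaussianReal_eq_integral_smul one_ne_zero]
  simp_rw [smul_eq_mul, gaussianPDFReal_mul_exp_quarter]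
  rw [integral_const_mul, integral_gaussian, ← Real.sqrt_inv, ← Real.sqrt_mul (by positivity)]
  congr 1; field_simp; norm_num

lemma integrable_pow_gaussianReal (k : ℕ) :
    Integrable (fun z : ℝ => z ^ k) (gaussianReal 0 1) := by
  have h := (memLp_id_gaussianReal (μ := 0) (v := 1) k).integrable_norm_pow'
  refine h.mono' (by fun_prop) (ae_of_all _ fun z => ?_)
  simp

/-- Correlation bound: with `S = a x y - b (x² + y²)` small, the kernel `exp S` has correlation at
most `2 δ ^ m` with `f ⊗ f` if the first `m` Gaussian moments of `f` vanish. -/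
lemma abs_integral_exp_kernel_le {f : ℝ → ℝ} (hfm : Measurable f) (hf1 : ∀ z, f z = 1 ∨ f z = -1)
    {m : ℕ} (hf : ∀ k < m, ∫ z, f z * z ^ k ∂gaussianReal 0 1 = 0) {a b δ : ℝ} (hδ0 : 0 ≤ δ)
    (hδ1 : δ ≤ 1)
    (hS : ∀ x y : ℝ, |a * x * y - b * (x ^ 2 + y ^ 2)| ≤ δ * ((x ^ 2 + y ^ 2) / 4)) :
    Integrable (fun p : ℝ × ℝ => f p.1 * f p.2 * Real.exp (a * p.1 * p.2 - b * (p.1 ^ 2 + p.2 ^ 2)))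
      ((gaussianReal 0 1).prod (gaussianReal 0 1)) ∧
    |∫ p : ℝ × ℝ, f p.1 * f p.2 * Real.exp (a * p.1 * p.2 - b * (p.1 ^ 2 + p.2 ^ 2))
      ∂(gaussianReal 0 1).prod (gaussianReal 0 1)| ≤ 2 * δ ^ m := by
  set γ := gaussianReal 0 1
  have habs : ∀ z, |f z| = 1 := fun z => by rcases hf1 z with h | h <;> simp [h]
  have hfint : ∀ k : ℕ, Integrable (fun z => f z * z ^ k) γ := fun k =>
    (integrable_pow_gaussianReal k).norm.mono' (by fun_prop) (ae_of_all _ fun z => by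
      rw [norm_mul, Real.norm_eq_abs (f z), habs, one_mul])
  have hE : Integrable (fun p : ℝ × ℝ => Real.exp (p.1 ^ 2 / 4) * Real.exp (p.2 ^ 2 / 4))
      (γ.prod γ) := integrable_exp_sq_quarter.mul_prod integrable_exp_sq_quarter
  have hexp : ∀ p : ℝ × ℝ, Real.exp ((p.1 ^ 2 + p.2 ^ 2) / 4)
      = Real.exp (p.1 ^ 2 / 4) * Real.exp (p.2 ^ 2 / 4) := fun p => by
    rw [← Real.exp_add]; congr 1; ring
  -- Needed for two values of `n`: 0 gives integrability of the full kernel, `m` gives the bound.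
  have hrem : ∀ n : ℕ, ∀ p : ℝ × ℝ, ‖f p.1 * f p.2 *
      (Real.exp (a * p.1 * p.2 - b * (p.1 ^ 2 + p.2 ^ 2)) - ∑ k ∈ Finset.range n,
        (a * p.1 * p.2 - b * (p.1 ^ 2 + p.2 ^ 2)) ^ k / (k.factorial : ℝ))‖
      ≤ δ ^ n * (Real.exp (p.1 ^ 2 / 4) * Real.exp (p.2 ^ 2 / 4)) := fun n p => by
    rw [Real.norm_eq_abs, abs_mul, abs_mul, habs, habs, one_mul, one_mul, ← hexp]
    exact abs_exp_sub_taylor_le hδ0 hδ1 (by positivity) (hS _ _) n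
  have hmeas : ∀ n : ℕ, Measurable fun p : ℝ × ℝ => f p.1 * f p.2 *
      (Real.exp (a * p.1 * p.2 - b * (p.1 ^ 2 + p.2 ^ 2)) - ∑ k ∈ Finset.range n,
        (a * p.1 * p.2 - b * (p.1 ^ 2 + p.2 ^ 2)) ^ k / (k.factorial : ℝ)) := fun n => by
    fun_prop
  have hint : ∀ n : ℕ, Integrable (fun p : ℝ × ℝ => f p.1 * f p.2 *
      (Real.exp (a * p.1 * p.2 - b * (p.1 ^ 2 + p.2 ^ 2)) - ∑ k ∈ Finset.range n,
        (a * p.1 * p.2 - b * (p.1 ^ 2 + p.2 ^ 2)) ^ k / (k.factorial : ℝ))) (γ.prod γ) := fun n =>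
    (hE.const_mul (δ ^ n)).mono' (hmeas n).aestronglyMeasurable (ae_of_all _ (hrem n))
  refine ⟨by simpa using hint 0, ?_⟩
  have hpow := fun k (hk : k < m) => integral_mul_quadratic_pow_eq_zero hfint hf a b hk
  have hzero : ∫ p : ℝ × ℝ, ∑ k ∈ Finset.range m, (k.factorial : ℝ)⁻¹ * (f p.1 * f p.2 *
      (a * p.1 * p.2 - b * (p.1 ^ 2 + p.2 ^ 2)) ^ k) ∂γ.prod γ = 0 := by
    rw [integral_finsetSum _ fun k hk => (hpow k (Finset.mem_range.1 hk)).1.const_mul _]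
    refine Finset.sum_eq_zero fun k hk => ?_
    rw [integral_const_mul, (hpow k (Finset.mem_range.1 hk)).2, mul_zero]
  have hsplit : ∫ p : ℝ × ℝ, f p.1 * f p.2 * Real.exp (a * p.1 * p.2 - b * (p.1 ^ 2 + p.2 ^ 2))
      ∂γ.prod γ = ∫ p : ℝ × ℝ, f p.1 * f p.2 *
      (Real.exp (a * p.1 * p.2 - b * (p.1 ^ 2 + p.2 ^ 2)) - ∑ k ∈ Finset.range m,
        (a * p.1 * p.2 - b * (p.1 ^ 2 + p.2 ^ 2)) ^ k / (k.factorial : ℝ)) ∂γ.prod γ := by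
    rw [← add_zero (∫ p : ℝ × ℝ, f p.1 * f p.2 * (_ - _) ∂γ.prod γ), ← hzero,
      ← integral_add (hint m) (integrable_finsetSum _ fun k hk =>
        (hpow k (Finset.mem_range.1 hk)).1.const_mul _)]
    refine integral_congr_ae (ae_of_all _ fun p => ?_)
    dsimp only
    have : ∑ k ∈ Finset.range m, (k.factorial : ℝ)⁻¹ * (f p.1 * f p.2 *
        (a * p.1 * p.2 - b * (p.1 ^ 2 + p.2 ^ 2)) ^ k) = f p.1 * f p.2 * ∑ k ∈ Finset.range m,
        (a * p.1 * p.2 - b * (p.1 ^ 2 + p.2 ^ 2)) ^ k / (k.factorial : ℝ) := by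
      rw [Finset.mul_sum]; exact Finset.sum_congr rfl fun k _ => by ring
    rw [this]; ring
  rw [hsplit, ← Real.norm_eq_abs]
  refine (norm_integral_le_of_norm_le (hE.const_mul (δ ^ m)) (ae_of_all _ (hrem m))).trans
    (le_of_eq ?_)
  rw [integral_const_mul, integral_prod_mul (fun x : ℝ => Real.exp (x ^ 2 / 4))
    (fun x : ℝ => Real.exp (x ^ 2 / 4)), integral_exp_sq_quarter,
    Real.mul_self_sqrt (by norm_num), mul_comm]

lemma charFunDual_gaussianReal_zero_one (L : StrongDual ℝ ℝ) :
    charFunDual (gaussianReal 0 1) L = Complex.exp (-((L 1 : ℝ) : ℂ) ^ 2 / 2) := by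
  rw [charFunDual_eq_charFun_map_one, gaussianReal_map_continuousLinearMap, charFun_gaussianReal]
  congr 1
  simp [neg_div, sq_nonneg]

/-! ### Two projections of a Gaussian vector. -/

section
variable {E : Type*} [NormedAddCommGroup E] [InnerProductSpace ℝ E] [FiniteDimensional ℝ E]
  [MeasurableSpace E] [BorelSpace E]

/-- The joint law of two linear functionals of a standard Gaussian vector. -/
lemma stdGaussian_map_inner_prodMk {u v : E} (hu : ‖u‖ = 1) (hv : ‖v‖ = 1) {s : ℝ}
    (hs : s ^ 2 = 1 - inner ℝ u v ^ 2) :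
    (stdGaussian E).map (fun x => (inner ℝ u x, inner ℝ v x)) =
      ((gaussianReal 0 1).prod (gaussianReal 0 1)).map
        (fun p : ℝ × ℝ => (p.1, inner ℝ u v * p.1 + s * p.2)) := by
  set ρ : ℝ := inner ℝ u v with hρ
  let L : E →L[ℝ] ℝ × ℝ := (innerSL ℝ u).prod (innerSL ℝ v)
  let M : ℝ × ℝ →L[ℝ] ℝ × ℝ := (ContinuousLinearMap.fst ℝ ℝ ℝ).prod
    (ρ • ContinuousLinearMap.fst ℝ ℝ ℝ + s • ContinuousLinearMap.snd ℝ ℝ ℝ)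
  change (stdGaussian E).map L = ((gaussianReal 0 1).prod (gaussianReal 0 1)).map M
  have : IsProbabilityMeasure ((stdGaussian E).map L) :=
    Measure.isProbabilityMeasure_map L.continuous.aemeasurable
  have : IsProbabilityMeasure (((gaussianReal 0 1).prod (gaussianReal 0 1)).map M) :=
    Measure.isProbabilityMeasure_map M.continuous.aemeasurable
  -- Both laws are centred Gaussian; comparing characteristic functions reduces to equality of the
  -- two quadratic forms in `T (1, 0)` and `T (0, 1)`.
  refine Measure.ext_of_charFunDual (funext fun T => ?_)
  rw [charFunDual_map, charFunDual_map, charFunDual_stdGaussian, charFunDual_prod,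
    charFunDual_gaussianReal_zero_one, charFunDual_gaussianReal_zero_one, ← Complex.exp_add]
  have hT : ∀ a b : ℝ, T (a, b) = a * T (1, 0) + b * T (0, 1) := fun a b => by
    rw [← smul_eq_mul, ← smul_eq_mul, ← map_smul, ← map_smul, ← map_add]; simp
  have h1 : T ∘SL L = innerSL ℝ (T (1, 0) • u + T (0, 1) • v) := by
    ext x
    rw [innerSL_apply_apply, inner_add_left, real_inner_smul_left, real_inner_smul_left]
    change T (inner ℝ u x, inner ℝ v x) = _
    rw [hT]; ring
  have h2 : ‖T (1, 0) • u + T (0, 1) • v‖ ^ 2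
      = T (1, 0) ^ 2 + T (0, 1) ^ 2 + 2 * ρ * T (1, 0) * T (0, 1) := by
    rw [norm_add_sq_real, norm_smul, norm_smul, hu, hv, real_inner_smul_left,
      real_inner_smul_right, ← hρ]
    simp; ring
  have h3 : ((T ∘SL M) ∘SL ContinuousLinearMap.inl ℝ ℝ ℝ) 1 = T (1, 0) + ρ * T (0, 1) := by
    simp [M, hT 1 ρ]
  have h4 : ((T ∘SL M) ∘SL ContinuousLinearMap.inr ℝ ℝ ℝ) 1 = s * T (0, 1) := by
    simp [M, hT 0 s]
  rw [h1, innerSL_apply_norm, h3, h4]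
  congr 1
  rw [← add_div, ← neg_add]
  congr 2
  norm_cast
  rw [h2, mul_pow, hs]; ring

lemma stdGaussian_map_inner {u : E} (hu : ‖u‖ = 1) :
    (stdGaussian E).map (fun x => inner ℝ u x) = gaussianReal 0 1 := by
  -- The degenerate case `u = v`, `s = 0` of the joint law suffices for the marginal.
  have h := congrArg (Measure.map Prod.fst)
    (stdGaussian_map_inner_prodMk hu hu (s := 0) (by simp [hu]))
  rw [Measure.map_map measurable_fst (by fun_prop), Measure.map_map measurable_fst (by fun_prop)] at h
  change _ = Measure.map Prod.fst _ at h
  rw [Measure.map_fst_prod] at h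
  simpa [Function.comp_def] using h

/-- Density of the law of `ρ x + s w` with respect to the standard Gaussian law. -/
lemma gaussianPDFReal_eq_exp_mul {ρ s : ℝ} (hs0 : 0 < s) (hs : s ^ 2 = 1 - ρ ^ 2) (x y : ℝ) :
    gaussianPDFReal (ρ * x) (Real.toNNReal (s ^ 2)) y = gaussianPDFReal 0 1 y * (s⁻¹ *
      Real.exp (ρ / (1 - ρ ^ 2) * x * y - ρ ^ 2 / (2 * (1 - ρ ^ 2)) * (x ^ 2 + y ^ 2))) := by
  have h0 : 1 - ρ ^ 2 ≠ 0 := by rw [← hs]; positivity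
  simp only [gaussianPDFReal, Real.coe_toNNReal _ (sq_nonneg s), NNReal.coe_one, mul_one, sub_zero]
  rw [Real.sqrt_mul (by positivity), Real.sqrt_sq hs0.le, mul_inv]
  rw [show ∀ A B C D : ℝ, A * B * (C * D) = A * C * (B * D) by intros; ring, ← Real.exp_add]
  congr 2
  rw [hs]; field_simp; ring

lemma gaussianReal_map_affine {s : ℝ} (c : ℝ) :
    (gaussianReal 0 1).map (fun w => c + s * w) = gaussianReal c (Real.toNNReal (s ^ 2)) := by
  have h : (fun w : ℝ => c + s * w) = (fun w => c + w) ∘ fun w => s * w := rfl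
  rw [h, ← Measure.map_map (by fun_prop) (by fun_prop), gaussianReal_map_const_mul,
    gaussianReal_map_const_add]
  congr 1
  · simp
  · ext; simp [sq_nonneg]

/-- If the first `m` Gaussian moments of `f` vanish, then `f ⟨u, ·⟩` and `f ⟨v, ·⟩` are nearly
uncorrelated. -/
theorem abs_integral_inner_mul_inner_le {f : ℝ → ℝ} (hfm : Measurable f)
    (hf1 : ∀ z, f z = 1 ∨ f z = -1) {m : ℕ}
    (hf : ∀ k < m, ∫ z, f z * z ^ k ∂gaussianReal 0 1 = 0) {u v : E} (hu : ‖u‖ = 1) (hv : ‖v‖ = 1)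
    (h0 : 0 ≤ inner ℝ u v) (h1 : 4 * inner ℝ u v ≤ 1) :
    |∫ x, f (inner ℝ u x) * f (inner ℝ v x) ∂stdGaussian E| ≤ 4 * (4 * inner ℝ u v) ^ m := by
  set ρ : ℝ := inner ℝ u v with hρ
  have hρ2 : ρ ^ 2 ≤ 1 / 16 := by nlinarith
  set s := Real.sqrt (1 - ρ ^ 2) with hs
  have hs2 : s ^ 2 = 1 - ρ ^ 2 := Real.sq_sqrt (by linarith)
  have hs0 : 0 < s := Real.sqrt_pos.2 (by linarith)
  have hsinv : s⁻¹ ≤ 2 := by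
    rw [inv_le_comm₀ hs0 (by norm_num)]; nlinarith
  set a := ρ / (1 - ρ ^ 2) with ha
  set b := ρ ^ 2 / (2 * (1 - ρ ^ 2)) with hb
  have hS : ∀ x y : ℝ, |a * x * y - b * (x ^ 2 + y ^ 2)| ≤ 4 * ρ * ((x ^ 2 + y ^ 2) / 4) := by
    intro x y
    have ha0 : 0 ≤ a := div_nonneg h0 (by linarith)
    have hb0 : 0 ≤ b := div_nonneg (sq_nonneg _) (by linarith)
    -- The left side equals ρ / (2(1 - ρ)), and ρ ≤ 1/4. This is where δ = 4ρ comes from.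
    have hab : a / 2 + b ≤ ρ := by
      rw [ha, hb, div_div, mul_comm (1 - ρ ^ 2) 2, ← add_div, div_le_iff₀ (by linarith)]
      nlinarith
    have hxy : |x * y| ≤ (x ^ 2 + y ^ 2) / 2 := by
      rw [abs_le]; constructor <;> nlinarith [sq_nonneg (x + y), sq_nonneg (x - y)]
    have hnn : 0 ≤ x ^ 2 + y ^ 2 := by positivity
    calc |a * x * y - b * (x ^ 2 + y ^ 2)| ≤ |a * x * y| + |b * (x ^ 2 + y ^ 2)| := abs_sub _ _
      _ = a * |x * y| + b * (x ^ 2 + y ^ 2) := by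
        rw [mul_assoc, abs_mul, abs_of_nonneg ha0, abs_of_nonneg (mul_nonneg hb0 hnn)]
      _ ≤ a * ((x ^ 2 + y ^ 2) / 2) + b * (x ^ 2 + y ^ 2) := by gcongr
      _ = (a / 2 + b) * (x ^ 2 + y ^ 2) := by ring
      _ ≤ ρ * (x ^ 2 + y ^ 2) := by gcongr
      _ = _ := by ring
  obtain ⟨hint, hle⟩ := abs_integral_exp_kernel_le hfm hf1 hf (by linarith) h1 hS
  set γ := gaussianReal 0 1
  have hff : ∀ g : ℝ × ℝ → ℝ × ℝ, Measurable g →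
      Integrable (fun p => f (g p).1 * f (g p).2) (γ.prod γ) := fun g hg =>
    integrable_of_eq_one_or (by fun_prop) fun p => by
      rcases hf1 (g p).1 with h | h <;> rcases hf1 (g p).2 with h' | h' <;> simp [h, h']
  -- Conditioned on `x`, the second projection is Gaussian with mean `ρ * x` and variance `s ^ 2`;
  -- its density relative to the standard Gaussian is the exponential kernel.
  have hkey : ∫ x, f (inner ℝ u x) * f (inner ℝ v x) ∂stdGaussian E = s⁻¹ *
      ∫ p : ℝ × ℝ, f p.1 * f p.2 * Real.exp (a * p.1 * p.2 - b * (p.1 ^ 2 + p.2 ^ 2)) ∂γ.prod γ := by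
    have hF : Measurable fun p : ℝ × ℝ => f p.1 * f p.2 := by fun_prop
    have e1 : ∫ x, f (inner ℝ u x) * f (inner ℝ v x) ∂stdGaussian E
        = ∫ p : ℝ × ℝ, f p.1 * f p.2
          ∂(stdGaussian E).map (fun x => (inner ℝ u x, inner ℝ v x)) :=
      (integral_map (φ := fun x : E => ((inner ℝ u x : ℝ), (inner ℝ v x : ℝ)))
        (by fun_prop) hF.aestronglyMeasurable).symm
    rw [e1, stdGaussian_map_inner_prodMk hu hv hs2, integral_map (by fun_prop)
      hF.aestronglyMeasurable, integral_prod _ (hff _ (by fun_prop)), integral_prod _ hint,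
      ← integral_const_mul]
    refine integral_congr_ae (ae_of_all _ fun x => ?_)
    dsimp only
    have e2 : ∫ w, f x * f (ρ * x + s * w) ∂γ
        = ∫ y, f x * f y ∂gaussianReal (ρ * x) (Real.toNNReal (s ^ 2)) := by
      rw [← gaussianReal_map_affine, integral_map (by fun_prop) (by fun_prop)]
    rw [← hρ, e2, integral_gaussianReal_eq_integral_smul (by simp; positivity),
      integral_gaussianReal_eq_integral_smul one_ne_zero, ← integral_const_mul]
    refine integral_congr_ae (ae_of_all _ fun y => ?_)
    dsimp only
    rw [gaussianPDFReal_eq_exp_mul hs0 hs2, smul_eq_mul, smul_eq_mul]; ring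
  rw [hkey, abs_mul, abs_of_pos (inv_pos.2 hs0)]
  calc _ ≤ 2 * (2 * (4 * ρ) ^ m) := by gcongr
    _ = _ := by ring

end

/-! ### Nearly orthogonal directions. -/

/-- Reed–Solomon codes give `p ^ m` unit vectors in dimension `d ≥ p ^ 2` with pairwise inner
products in `[0, m / p]`. -/
lemma exists_nearly_orthogonal_family {d p : ℕ} [Fact p.Prime] (hp : p ^ 2 ≤ d) (m : ℕ) :
    ∃ V : (Fin m → ZMod p) → EuclideanSpace ℝ (Fin d), (∀ i, ‖V i‖ = 1) ∧
      ∀ i j, i ≠ j → 0 ≤ inner ℝ (V i) (V j) ∧ inner ℝ (V i) (V j) ≤ (m / p : ℝ) := by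
  classical
  have hp0 : (0 : ℝ) < p := by exact_mod_cast (Fact.out : p.Prime).pos
  obtain ⟨e⟩ : Nonempty (ZMod p × ZMod p ↪ Fin d) :=
    Function.Embedding.nonempty_of_card_le (by simpa [ZMod.card, ← sq] using hp)
  have hb : Orthonormal ℝ fun i => EuclideanSpace.basisFun (Fin d) ℝ (e i) :=
    (EuclideanSpace.basisFun (Fin d) ℝ).orthonormal.comp e e.injective
  let G : (Fin m → ZMod p) → Polynomial (ZMod p) := fun c =>
    ((Polynomial.degreeLTEquiv (ZMod p) m).symm c : Polynomial.degreeLT (ZMod p) m)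
  have hGdeg : ∀ c, (G c).degree < m := fun c =>
    Polynomial.mem_degreeLT.1 ((Polynomial.degreeLTEquiv (ZMod p) m).symm c).2
  have hGinj : Function.Injective G := fun c c' h =>
    (Polynomial.degreeLTEquiv (ZMod p) m).symm.injective (Subtype.ext h)
  -- The normalized indicator of the graph of a polynomial over `ZMod p`; inner products count
  -- agreements.
  let V : (Fin m → ZMod p) → EuclideanSpace ℝ (Fin d) := fun c =>
    ∑ a, (Real.sqrt p)⁻¹ • EuclideanSpace.basisFun (Fin d) ℝ (e (a, (G c).eval a))
  have hinner : ∀ c c', inner ℝ (V c) (V c') =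
      ((Finset.univ.filter fun a => (G c).eval a = (G c').eval a).card : ℝ) / p := fun c c' => by
    simp only [V, sum_inner, inner_sum, real_inner_smul_left, real_inner_smul_right,
      orthonormal_iff_ite.1 hb, Prod.mk.injEq]
    rw [Finset.card_filter, Nat.cast_sum, Finset.sum_div]
    refine Finset.sum_congr rfl fun a _ => ?_
    rw [Finset.sum_eq_single a]
    · rw [← mul_assoc, ← mul_inv, Real.mul_self_sqrt hp0.le]
      by_cases h : (G c).eval a = (G c').eval a <;> simp [h]
    · intro a' _ ha'; simp [ha']
    · simp
  refine ⟨V, fun c => ?_, fun c c' hc => ⟨?_, ?_⟩⟩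
  · have h := real_inner_self_eq_norm_sq (V c)
    rw [hinner] at h
    simp only [Finset.filter_true, Finset.card_univ, ZMod.card] at h
    rw [div_self hp0.ne'] at h
    exact (pow_eq_one_iff_of_nonneg (norm_nonneg _) two_ne_zero).1 h.symm
  · rw [hinner]; positivity
  · rw [hinner]
    gcongr
    have hne : G c - G c' ≠ 0 := sub_ne_zero.2 (hGinj.ne hc)
    have hsub : (Finset.univ.filter fun a => (G c).eval a = (G c').eval a) ⊆
        (G c - G c').roots.toFinset := fun a ha => by
      rw [Multiset.mem_toFinset, Polynomial.mem_roots hne]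
      simpa [sub_eq_zero] using ha
    have hd : (G c - G c').natDegree < m := by
      rw [Polynomial.natDegree_lt_iff_degree_lt hne]
      exact (Polynomial.degree_sub_le _ _).trans_lt (max_lt (hGdeg c) (hGdeg c'))
    exact (Finset.card_le_card hsub).trans ((Multiset.toFinset_card_le _).trans
      ((Polynomial.card_roots' _).trans hd.le))

/-! ### Few labelings correlate with one query. -/

/-- A bounded function has correlation more than `τ` with few members of a nearly uncorrelated
family of `±1`-valued functions. -/
lemma card_mul_le_one_of_correlated {α ι : Type*} [MeasurableSpace α] {μ : Measure α}
    [IsProbabilityMeasure μ] {F : ι → α → ℝ} (hFm : ∀ i, Measurable (F i))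
    (hF1 : ∀ i x, F i x = 1 ∨ F i x = -1) {η τ : ℝ} (hη : 0 ≤ η) (hτ : 0 ≤ τ)
    (hcorr : ∀ i j, i ≠ j → |∫ x, F i x * F j x ∂μ| ≤ η) {b : α → ℝ} (hbm : Measurable b)
    (hb : ∀ x, |b x| ≤ 1) (B : Finset ι) (hB : ∀ i ∈ B, τ ≤ |∫ x, b x * F i x ∂μ|) :
    (B.card : ℝ) * (τ ^ 2 - η) ≤ 1 := by
  classical
  have hsgn : ∀ r : ℝ, ∃ s : ℝ, (s = 1 ∨ s = -1) ∧ s * r = |r| := fun r => by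
    rcases le_total 0 r with h | h
    · exact ⟨1, Or.inl rfl, by rw [abs_of_nonneg h, one_mul]⟩
    · exact ⟨-1, Or.inr rfl, by rw [abs_of_nonpos h, neg_one_mul]⟩
  choose s hs hs' using fun i => hsgn (∫ x, b x * F i x ∂μ)
  have hbF : ∀ i, Integrable (fun x => b x * F i x) μ := fun i =>
    Integrable.of_bound (C := 1) (hbm.mul (hFm i)).aestronglyMeasurable (ae_of_all _ fun x => by
      rcases hF1 i x with h | h <;> simpa [h] using hb x)
  have hFF : ∀ i j, Integrable (fun x => F i x * F j x) μ := fun i j =>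
    integrable_of_eq_one_or ((hFm i).mul (hFm j)) fun x => by
      rcases hF1 i x with h | h <;> rcases hF1 j x with h' | h' <;> simp [h, h']
  set H : α → ℝ := fun x => ∑ i ∈ B, s i * F i x
  have hbH : ∀ x, b x * H x = ∑ i ∈ B, s i * (b x * F i x) := fun x => by
    simp only [H, Finset.mul_sum]; exact Finset.sum_congr rfl fun i _ => by ring
  have hHH : ∀ x, H x ^ 2 = ∑ i ∈ B, ∑ j ∈ B, s i * s j * (F i x * F j x) := fun x => by
    simp only [H, sq, Finset.sum_mul_sum]
    exact Finset.sum_congr rfl fun i _ => Finset.sum_congr rfl fun j _ => by ring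
  have hbHint : Integrable (fun x => b x * H x) μ := by
    simp only [hbH]; exact integrable_finsetSum _ fun i _ => (hbF i).const_mul _
  have hHHint : Integrable (fun x => H x ^ 2) μ := by
    simp only [hHH]
    exact integrable_finsetSum _ fun i _ => integrable_finsetSum _ fun j _ => (hFF i j).const_mul _
  set n : ℝ := (B.card : ℝ)
  have h1 : τ * n ≤ ∫ x, b x * H x ∂μ := by
    simp only [hbH]
    rw [integral_finsetSum _ fun i _ => (hbF i).const_mul _]
    calc τ * n = ∑ _i ∈ B, τ := by simp [n, mul_comm]
      _ ≤ _ := Finset.sum_le_sum fun i hi => by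
        rw [integral_const_mul, hs' i]; exact hB i hi
  have h2 : ∫ x, H x ^ 2 ∂μ ≤ n + n ^ 2 * η := by
    simp only [hHH]
    rw [integral_finsetSum _ fun i _ => integrable_finsetSum _ fun j _ => (hFF i j).const_mul _]
    calc _ ≤ ∑ i ∈ B, ∑ j ∈ B, ((if i = j then 1 else 0) + η) := by
          refine Finset.sum_le_sum fun i _ => ?_
          rw [integral_finsetSum _ fun j _ => (hFF i j).const_mul _]
          refine Finset.sum_le_sum fun j _ => ?_
          rw [integral_const_mul]
          by_cases hij : i = j
          · subst hij
            have : ∀ x, F i x * F i x = 1 := fun x => by rcases hF1 i x with h | h <;> simp [h]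
            have hss : s i * s i = 1 := by rcases hs i with h | h <;> simp [h]
            simp [this, hss, hη]
          · refine (le_abs_self _).trans ?_
            have hss : |s i * s j| = 1 := by
              rcases hs i with h | h <;> rcases hs j with h' | h' <;> simp [h, h']
            rw [abs_mul, hss, one_mul, if_neg hij, zero_add]
            exact hcorr i j hij
      _ = _ := by
        simp only [Finset.sum_add_distrib, Finset.sum_ite_eq, Finset.sum_const, nsmul_eq_mul]
        simp [n]; ring
  have hn : 0 ≤ n := Nat.cast_nonneg _
  -- Cauchy–Schwarz in the form `0 ≤ (H - τ * n * b) ^ 2`, using `b ^ 2 ≤ 1`.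
  have h3 : 2 * (τ * n) * ∫ x, b x * H x ∂μ ≤ (∫ x, H x ^ 2 ∂μ) + (τ * n) ^ 2 := by
    have : ∫ x, 2 * (τ * n) * (b x * H x) ∂μ ≤ ∫ x, (H x ^ 2 + (τ * n) ^ 2) ∂μ :=
      integral_mono (hbHint.const_mul _) (hHHint.add (integrable_const _)) fun x => by
        have hb2 : b x ^ 2 ≤ 1 := (sq_le_one_iff_abs_le_one _).2 (hb x)
        dsimp only
        nlinarith [sq_nonneg (H x - τ * n * b x), mul_le_mul_of_nonneg_left hb2 (sq_nonneg (τ * n))]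
    rwa [integral_const_mul, integral_add hHHint (integrable_const _), integral_const,
      probReal_univ, one_smul] at this
  have h4 : (τ * n) ^ 2 ≤ n + n ^ 2 * η := by
    nlinarith [mul_le_mul_of_nonneg_left h1 (mul_nonneg hτ hn)]
  rcases hn.eq_or_lt with h | h
  · rw [← h]; simp
  · have : n * (n * (τ ^ 2 - η)) ≤ n * 1 := by nlinarith
    exact le_of_mul_le_mul_left this h

/-! ### Labelled distributions, their errors and OPT. -/

section
variable {d : ℕ}

/-- The real number `r`, clamped to `[-1, 1]`, as a label. -/
noncomputable def toLabel (r : ℝ) : Set.Icc (-1 : ℝ) 1 := Set.projIcc (-1) 1 (by norm_num) r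

lemma measurable_toLabel : Measurable toLabel :=
  (continuous_projIcc (h := show (-1 : ℝ) ≤ 1 by norm_num)).measurable

lemma coe_toLabel {r : ℝ} (hr : r = 1 ∨ r = -1) : (toLabel r : ℝ) = r := by
  rw [toLabel, Set.projIcc_of_mem]; rcases hr with h | h <;> simp [h]

/-- The distribution of `(x, g x)` for a standard Gaussian vector `x`. -/
noncomputable def labeledBy (g : EuclideanSpace ℝ (Fin d) → ℝ) : Measure (LabeledExample d) :=
  (stdGaussian (EuclideanSpace ℝ (Fin d))).map fun x => (x, toLabel (g x))

/-- The distribution of `(x, y)` for a standard Gaussian vector `x` and an independent uniform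
label `y ∈ {±1}`. -/
noncomputable def uniformlyLabeled (d : ℕ) : Measure (LabeledExample d) :=
  (2⁻¹ : ENNReal) • labeledBy (fun _ => 1) + (2⁻¹ : ENNReal) • labeledBy (fun _ => -1)

lemma measurable_prodMk_toLabel {g : EuclideanSpace ℝ (Fin d) → ℝ} (hg : Measurable g) :
    Measurable fun x => (x, toLabel (g x)) :=
  measurable_id.prodMk (measurable_toLabel.comp hg)

lemma isGaussianInstance_labeledBy {g : EuclideanSpace ℝ (Fin d) → ℝ} (hg : Measurable g)
    (hg1 : ∀ x, g x = 1 ∨ g x = -1) : IsGaussianInstance (labeledBy g) where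
  marginal := by
    rw [labeledBy, Measure.map_map measurable_fst (measurable_prodMk_toLabel hg)]
    exact Measure.map_id
  labels := by
    have hm : Measurable fun p : LabeledExample d => (p.2 : ℝ) :=
      measurable_subtype_coe.comp measurable_snd
    rw [labeledBy, ae_map_iff (p := fun p : LabeledExample d => (p.2 : ℝ) = 1 ∨ (p.2 : ℝ) = -1)
      (measurable_prodMk_toLabel hg).aemeasurable
      ((hm (measurableSet_singleton 1)).union (hm (measurableSet_singleton (-1))))]
    exact ae_of_all _ fun x => by rw [coe_toLabel (hg1 x)]; exact hg1 x

lemma isGaussianInstance_uniformlyLabeled : IsGaussianInstance (uniformlyLabeled d) where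
  marginal := by
    rw [uniformlyLabeled, Measure.map_add _ _ measurable_fst, Measure.map_smul, Measure.map_smul,
      (isGaussianInstance_labeledBy measurable_const fun _ => Or.inl rfl).marginal,
      (isGaussianInstance_labeledBy measurable_const fun _ => Or.inr rfl).marginal,
      ← add_smul, ENNReal.inv_two_add_inv_two, one_smul]
  labels := by
    rw [uniformlyLabeled, ae_add_measure_iff]
    exact ⟨Measure.ae_smul_measure
        (isGaussianInstance_labeledBy measurable_const fun _ => Or.inl rfl).labels _,
      Measure.ae_smul_measure
        (isGaussianInstance_labeledBy measurable_const fun _ => Or.inr rfl).labels _⟩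

namespace StatQuery

/-- The part of a query that is odd in the label. -/
noncomputable def oddPart (q : StatQuery d) (x : EuclideanSpace ℝ (Fin d)) : ℝ :=
  (q.toFun (x, toLabel 1) - q.toFun (x, toLabel (-1))) / 2

lemma measurable_apply_toLabel (q : StatQuery d) {g : EuclideanSpace ℝ (Fin d) → ℝ}
    (hg : Measurable g) : Measurable fun x => q.toFun (x, toLabel (g x)) :=
  q.measurable.comp (measurable_prodMk_toLabel hg)

lemma integrable_apply_toLabel (q : StatQuery d) {g : EuclideanSpace ℝ (Fin d) → ℝ}
    (hg : Measurable g) :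
    Integrable (fun x => q.toFun (x, toLabel (g x))) (stdGaussian (EuclideanSpace ℝ (Fin d))) :=
  Integrable.of_bound (C := 1) (q.measurable_apply_toLabel hg).aestronglyMeasurable
    (ae_of_all _ fun _ => abs_le.2 (q.mem_Icc _))

lemma measurable_oddPart (q : StatQuery d) : Measurable q.oddPart :=
  ((q.measurable_apply_toLabel measurable_const).sub
    (q.measurable_apply_toLabel measurable_const)).div_const 2

lemma abs_oddPart_le_one (q : StatQuery d) (x : EuclideanSpace ℝ (Fin d)) : |q.oddPart x| ≤ 1 := by
  have h1 := q.mem_Icc (x, toLabel 1)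
  have h2 := q.mem_Icc (x, toLabel (-1))
  simp only [Set.mem_Icc] at h1 h2
  rw [oddPart, abs_le]; constructor <;> linarith

lemma integral_labeledBy (q : StatQuery d) {g : EuclideanSpace ℝ (Fin d) → ℝ} (hg : Measurable g) :
    ∫ p, q.toFun p ∂labeledBy g =
      ∫ x, q.toFun (x, toLabel (g x)) ∂stdGaussian (EuclideanSpace ℝ (Fin d)) :=
  integral_map (measurable_prodMk_toLabel hg).aemeasurable q.measurable.aestronglyMeasurable

lemma integrable_labeledBy (q : StatQuery d) {g : EuclideanSpace ℝ (Fin d) → ℝ}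
    (hg : Measurable g) : Integrable q.toFun (labeledBy g) :=
  (integrable_map_measure q.measurable.aestronglyMeasurable
    (measurable_prodMk_toLabel hg).aemeasurable).2 (q.integrable_apply_toLabel hg)

/-- The answers for `labeledBy g` and for uniform labels differ by the correlation of `g` with the
odd part of the query. -/
lemma integral_labeledBy_sub (q : StatQuery d) {g : EuclideanSpace ℝ (Fin d) → ℝ}
    (hg : Measurable g) (hg1 : ∀ x, g x = 1 ∨ g x = -1) :
    ∫ p, q.toFun p ∂labeledBy g - ∫ p, q.toFun p ∂uniformlyLabeled d =
      ∫ x, q.oddPart x * g x ∂stdGaussian (EuclideanSpace ℝ (Fin d)) := by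
  have h1 := (q.integrable_apply_toLabel (measurable_const (a := (1 : ℝ)))).const_mul
    (2⁻¹ : ENNReal).toReal
  have h2 := (q.integrable_apply_toLabel (measurable_const (a := (-1 : ℝ)))).const_mul
    (2⁻¹ : ENNReal).toReal
  have h3 : Integrable (fun x => (2⁻¹ : ENNReal).toReal * q.toFun (x, toLabel 1) +
      (2⁻¹ : ENNReal).toReal * q.toFun (x, toLabel (-1))) (stdGaussian (EuclideanSpace ℝ (Fin d))) :=
    h1.add h2
  rw [uniformlyLabeled, integral_add_measure
    ((q.integrable_labeledBy measurable_const).smul_measure (by simp))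
    ((q.integrable_labeledBy measurable_const).smul_measure (by simp)), integral_smul_measure,
    integral_smul_measure, q.integral_labeledBy hg, q.integral_labeledBy measurable_const,
    q.integral_labeledBy measurable_const, smul_eq_mul, smul_eq_mul, ← integral_const_mul,
    ← integral_const_mul, ← integral_add h1 h2, ← integral_sub (q.integrable_apply_toLabel hg) h3]
  -- For a label `y = ±1` the query is its average over both labels plus `y` times its odd part; the
  -- average cancels.
  refine integral_congr_ae (ae_of_all _ fun x => ?_)
  simp only [oddPart, ENNReal.toReal_inv, ENNReal.toReal_ofNat]
  rcases hg1 x with h | h <;> rw [h] <;> ring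

end StatQuery

lemma zeroOneError_labeledBy {g h : EuclideanSpace ℝ (Fin d) → ℝ} (hg : Measurable g)
    (hg1 : ∀ x, g x = 1 ∨ g x = -1) (hh : Measurable h) (hh1 : ∀ x, h x = 1 ∨ h x = -1) :
    zeroOneError (labeledBy g) h =
      1 / 2 - (∫ x, h x * g x ∂stdGaussian (EuclideanSpace ℝ (Fin d))) / 2 := by
  have hS : MeasurableSet {x | h x ≠ g x} := (measurableSet_eq_fun hh hg).compl
  have hm : MeasurableSet {p : LabeledExample d | h p.1 ≠ (p.2 : ℝ)} :=
    (measurableSet_eq_fun (hh.comp measurable_fst)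
      (measurable_subtype_coe.comp measurable_snd)).compl
  have hpre : (fun x => (x, toLabel (g x))) ⁻¹' {p : LabeledExample d | h p.1 ≠ (p.2 : ℝ)}
      = {x | h x ≠ g x} := by
    ext x; simp only [Set.mem_preimage, Set.mem_ofPred_eq, coe_toLabel (hg1 x)]
  have hint : Integrable (fun x => h x * g x) (stdGaussian (EuclideanSpace ℝ (Fin d))) :=
    integrable_of_eq_one_or (hh.mul hg) fun x => by
      rcases hh1 x with h | h <;> rcases hg1 x with h' | h' <;> simp [h, h']
  rw [zeroOneError, labeledBy, map_measureReal_apply (measurable_prodMk_toLabel hg) hm, hpre,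
    ← integral_indicator_one hS]
  have : ∀ x, {x | h x ≠ g x}.indicator (1 : EuclideanSpace ℝ (Fin d) → ℝ) x
      = 1 / 2 - h x * g x / 2 := fun x => by
    by_cases hx : h x = g x
    · rw [Set.indicator_of_notMem (by simpa using hx), hx]
      rcases hg1 x with h' | h' <;> rw [h'] <;> norm_num
    · rw [Set.indicator_of_mem (by simpa using hx)]
      rcases hh1 x with h | h <;> rcases hg1 x with h' | h' <;> simp [h, h'] at hx ⊢ <;> norm_num
  simp only [this]
  rw [integral_sub (integrable_const _) (hint.div_const 2), integral_const, probReal_univ, one_smul,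
    integral_div]

/-- At every point `h` errs for exactly one of the labels `g x` and `-g x`. Hence no single
hypothesis has error below 1/2 for both labelings. -/
lemma zeroOneError_labeledBy_add_neg {g h : EuclideanSpace ℝ (Fin d) → ℝ} (hg : Measurable g)
    (hg1 : ∀ x, g x = 1 ∨ g x = -1) (hh : Measurable h) (hh1 : ∀ x, h x = 1 ∨ h x = -1) :
    zeroOneError (labeledBy g) h + zeroOneError (labeledBy fun x => -g x) h = 1 := by
  have hg1' : ∀ x, -g x = 1 ∨ -g x = -1 := fun x => by rcases hg1 x with h | h <;> simp [h]
  rw [zeroOneError_labeledBy hg hg1 hh hh1, zeroOneError_labeledBy (g := fun x => -g x) hg.neg hg1' hh hh1]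
  simp only [mul_neg, integral_neg]; ring

lemma measurable_halfspace (w : EuclideanSpace ℝ (Fin d)) (θ : ℝ) : Measurable (halfspace w θ) :=
  Measurable.ite (measurableSet_le measurable_const (by fun_prop)) measurable_const measurable_const

lemma halfspace_eq_one_or (w : EuclideanSpace ℝ (Fin d)) (θ : ℝ) (x : EuclideanSpace ℝ (Fin d)) :
    halfspace w θ x = 1 ∨ halfspace w θ x = -1 := by
  unfold halfspace; split_ifs <;> simp

lemma optHalfspaceError_le (D : Measure (LabeledExample d)) (w : EuclideanSpace ℝ (Fin d))
    (θ : ℝ) : optHalfspaceError D ≤ zeroOneError D (halfspace w θ) :=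
  ciInf_le (f := fun a : EuclideanSpace ℝ (Fin d) × ℝ => zeroOneError D (halfspace a.1 a.2))
    ⟨0, by rintro _ ⟨a, rfl⟩; exact measureReal_nonneg⟩ (w, θ)

/-- A correlation of `f` with a threshold function bounds `OPT` for the labels `σ f ⟨v, x⟩`. -/
lemma optHalfspaceError_labeledBy_le {f : ℝ → ℝ} (hf : Measurable f)
    (hf1 : ∀ z, f z = 1 ∨ f z = -1) {v : EuclideanSpace ℝ (Fin d)} (hv : ‖v‖ = 1) {t κ σ : ℝ}
    (hσ : σ = 1 ∨ σ = -1) (hκ : κ ≤ |∫ z, f z * stepSign t z ∂gaussianReal 0 1|) :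
    optHalfspaceError (labeledBy fun x => σ * f (inner ℝ v x)) ≤ 1 / 2 - κ / 2 := by
  set γ := stdGaussian (EuclideanSpace ℝ (Fin d))
  set I := ∫ z, f z * stepSign t z ∂gaussianReal 0 1
  have hmap : ∫ x, f (inner ℝ v x) * stepSign t (inner ℝ v x) ∂γ = I := by
    simp only [I]
    rw [← stdGaussian_map_inner hv, integral_map (f := fun z => f z * stepSign t z) (by fun_prop)
      (hf.mul (measurable_stepSign t)).aestronglyMeasurable]
  have hgm : Measurable fun x : EuclideanSpace ℝ (Fin d) => σ * f (inner ℝ v x) := by fun_prop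
  have hg1 : ∀ x, σ * f (inner ℝ v x) = 1 ∨ σ * f (inner ℝ v x) = -1 := fun x => by
    rcases hσ with h | h <;> rcases hf1 (inner ℝ v x) with h' | h' <;> simp [h, h']
  have hpos : ∫ x, halfspace v (-t) x * (σ * f (inner ℝ v x)) ∂γ = σ * I := by
    rw [← hmap, ← integral_const_mul]
    refine integral_congr_ae (ae_of_all _ fun x => ?_)
    have : halfspace v (-t) x = stepSign t (inner ℝ v x) := by
      simp only [halfspace, stepSign, ← sub_eq_add_neg, sub_nonneg]
    dsimp only
    rw [this]; ring
  -- The sign of the correlation is unknown, so both orientations are needed. The reversed halfspace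
  -- equals minus the threshold only off the null set `⟨v, x⟩ = t`.
  have hneg : ∫ x, halfspace (-v) t x * (σ * f (inner ℝ v x)) ∂γ = -(σ * I) := by
    rw [← hmap, ← integral_const_mul, ← integral_neg]
    have hne : ∀ᵐ x ∂γ, inner ℝ v x ≠ t := by
      have : ∀ᵐ z ∂gaussianReal 0 1, z ≠ t := by
        have := nullSingletonClass_gaussianReal (μ := 0) (v := 1) one_ne_zero
        exact compl_mem_ae_iff.2 (measure_singleton t)
      rw [← stdGaussian_map_inner hv] at this
      exact ae_of_ae_map (f := fun x => inner ℝ v x) (by fun_prop) this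
    refine integral_congr_ae ?_
    filter_upwards [hne] with x hx
    have : halfspace (-v) t x = -stepSign t (inner ℝ v x) := by
      simp only [halfspace, stepSign, inner_neg_left]
      rcases lt_or_gt_of_ne hx with h | h
      · rw [if_pos (by linarith), if_neg (by linarith)]; simp
      · rw [if_neg (by linarith), if_pos h.le]
    rw [this]; ring
  have habs : κ ≤ |σ * I| := by
    rcases hσ with h | h <;> simpa [h] using hκ
  rcases abs_cases (σ * I) with h | h
  · refine (optHalfspaceError_le _ v (-t)).trans ?_
    rw [zeroOneError_labeledBy hgm hg1 (measurable_halfspace _ _) (halfspace_eq_one_or _ _), hpos]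
    linarith [h.1]
  · refine (optHalfspaceError_le _ (-v) t).trans ?_
    rw [zeroOneError_labeledBy hgm hg1 (measurable_halfspace _ _) (halfspace_eq_one_or _ _), hneg]
    linarith [h.1]

end

/-! ### The adversary argument. -/

namespace SQAlgorithm

/-- The queries that the algorithm asks when they are answered by `O`. -/
def queries {d : ℕ} (O : StatQuery d → ℝ) : SQAlgorithm d → List (StatQuery d)
  | output _ => []
  | query q next => q :: queries O (next (O q))

lemma length_queries {d : ℕ} (O : StatQuery d → ℝ) (a : SQAlgorithm d) :
    (a.queries O).length = a.numQueries O := by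
  induction a with
  | output h => rfl
  | query q next ih => simp [queries, numQueries, ih]

/-- Agreement on the queries asked under `O` is enough: by induction the run under `O'` follows the
same branch. -/
lemma run_congr {d : ℕ} {O O' : StatQuery d → ℝ} (a : SQAlgorithm d)
    (h : ∀ q ∈ a.queries O, O' q = O q) : a.run O' = a.run O := by
  induction a with
  | output h => rfl
  | query q next ih =>
    simp only [queries, List.mem_cons, forall_eq_or_imp] at h
    simp only [run, h.1]
    exact ih _ h.2

end SQAlgorithm

/-- The oracle for `D` that gives the answer for `D₀` whenever it is valid for `D`. -/
noncomputable def impostorOracle {d : ℕ} (D₀ D : Measure (LabeledExample d)) (τ : ℝ)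
    (q : StatQuery d) : ℝ :=
  open Classical in
  if |∫ p, q.toFun p ∂D₀ - ∫ p, q.toFun p ∂D| ≤ τ then ∫ p, q.toFun p ∂D₀ else ∫ p, q.toFun p ∂D

lemma impostorOracle_mem_STAT {d : ℕ} (D₀ D : Measure (LabeledExample d)) {τ : ℝ} (hτ : 0 ≤ τ) :
    impostorOracle D₀ D τ ∈ STAT D τ := fun q => by
  unfold impostorOracle
  split_ifs with h
  · exact h
  · simpa using hτ

/-- If almost every point lies in at least `n` of the sets `S j`, not necessarily measurable, then
their outer measures sum to at least `n`. -/
lemma natCast_le_sum_measure {Ω κ : Type*} [MeasurableSpace Ω] {μ : Measure Ω}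
    [IsProbabilityMeasure μ] [Fintype κ] (S : κ → Set Ω) (n : ℕ)
    (h : ∀ᵐ ω ∂μ, ∃ J : Finset κ, n ≤ J.card ∧ ∀ j ∈ J, ω ∈ S j) :
    (n : ENNReal) ≤ ∑ j, μ (S j) := by
  calc (n : ENNReal) = ∫⁻ _, n ∂μ := by simp
    _ ≤ ∫⁻ ω, ∑ j, (toMeasurable μ (S j)).indicator 1 ω ∂μ := by
      refine lintegral_mono_ae ?_
      filter_upwards [h] with ω ⟨J, hJ, hmem⟩
      calc (n : ENNReal) ≤ (J.card : ENNReal) := by exact_mod_cast hJ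
        _ = ∑ j ∈ J, (1 : ENNReal) := by simp
        _ = ∑ j ∈ J, (toMeasurable μ (S j)).indicator 1 ω := Finset.sum_congr rfl fun j hj => by
          rw [Set.indicator_of_mem (subset_toMeasurable μ _ (hmem j hj))]; rfl
        _ ≤ _ := Finset.sum_le_univ_sum_of_nonneg fun _ => zero_le
    _ = ∑ j, μ (S j) := by
      rw [lintegral_finsetSum _ fun j _ =>
        measurable_one.indicator (measurableSet_toMeasurable μ (S j))]
      refine Finset.sum_congr rfl fun j _ => ?_
      rw [lintegral_indicator_one (measurableSet_toMeasurable μ _), measure_toMeasurable]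

/-- Statistical query lower bound from a family of labelings `g i` such that `OPT` for `± g i` is
less than `1 / 2 - ε` and every query is correlated with at most `K` of them. -/
theorem exists_many_queries {d : ℕ} {Ω : Type*} [MeasurableSpace Ω] {μ : Measure Ω}
    [IsProbabilityMeasure μ] {A : Ω → SQAlgorithm d} {ε τ T K : ℝ} (hτ : 0 ≤ τ) (hK : 0 ≤ K)
    (hA : AgnosticallyLearnsHalfspaces μ A ε τ) {ι : Type*} [Fintype ι]
    {g : ι → EuclideanSpace ℝ (Fin d) → ℝ} (hg : ∀ i, Measurable (g i))
    (hg1 : ∀ i x, g i x = 1 ∨ g i x = -1)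
    (hopt : ∀ i, ∀ σ : ℝ, σ = 1 ∨ σ = -1 →
      optHalfspaceError (labeledBy fun x => σ * g i x) + ε < 1 / 2)
    (hq : ∀ (q : StatQuery d) (B : Finset ι),
      (∀ i ∈ B, τ ≤ |∫ x, q.oddPart x * g i x ∂stdGaussian (EuclideanSpace ℝ (Fin d))|) →
      (B.card : ℝ) ≤ K)
    (hcard : 3 * (T * K) < Fintype.card ι) :
    ∃ D : Measure (LabeledExample d), IsGaussianInstance D ∧ ∃ O ∈ STAT D τ,
      0 < μ {ω | T ≤ ((A ω).numQueries O : ℝ)} := by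
  classical
  -- The hard instance has pure noise labels and exact answers; the structured instances serve only
  -- to contradict learning.
  set D₀ := uniformlyLabeled d
  set O₀ : StatQuery d → ℝ := fun q => ∫ p, q.toFun p ∂D₀
  refine ⟨D₀, isGaussianInstance_uniformlyLabeled, O₀, fun q => by simpa [O₀] using hτ, ?_⟩
  rw [pos_iff_ne_zero]
  intro hzero
  have hfew : ∀ᵐ ω ∂μ, ((A ω).numQueries O₀ : ℝ) < T := by
    filter_upwards [measure_eq_zero_iff_ae_notMem.1 hzero] with ω hω
    exact not_le.1 hω
  let sgn : Bool → ℝ := fun b => if b then 1 else -1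
  have hsgn : ∀ b, sgn b = 1 ∨ sgn b = -1 := fun b => by cases b <;> simp [sgn]
  let D : ι × Bool → Measure (LabeledExample d) := fun j => labeledBy fun x => sgn j.2 * g j.1 x
  have hm : ∀ j : ι × Bool, Measurable fun x => sgn j.2 * g j.1 x := fun j => (hg j.1).const_mul _
  have h1 : ∀ (j : ι × Bool) x, sgn j.2 * g j.1 x = 1 ∨ sgn j.2 * g j.1 x = -1 := fun j x => by
    rcases hsgn j.2 with h | h <;> rcases hg1 j.1 x with h' | h' <;> simp [h, h']
  let O : ι × Bool → StatQuery d → ℝ := fun j => impostorOracle D₀ (D j) τ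
  let S : ι × Bool → Set Ω := fun j =>
    {ω | ¬ zeroOneError (D j) ((A ω).run (O j)).toFun ≤ optHalfspaceError (D j) + ε}
  have hS : ∀ j, μ (S j) ≤ 1 / 3 := fun j =>
    hA (D j) (isGaussianInstance_labeledBy (hm j) (h1 j)) _ (impostorOracle_mem_STAT _ _ hτ)
  let bad : StatQuery d → Finset ι := fun q => Finset.univ.filter fun i =>
    τ ≤ |∫ x, q.oddPart x * g i x ∂stdGaussian (EuclideanSpace ℝ (Fin d))|
  have hgood : ∀ (q : StatQuery d) (j : ι × Bool), j.1 ∉ bad q → O j q = O₀ q := by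
    intro q j hj
    have hlt : |∫ x, q.oddPart x * g j.1 x ∂stdGaussian (EuclideanSpace ℝ (Fin d))| < τ := by
      simpa [bad] using hj
    refine if_pos ?_
    rw [abs_sub_comm, q.integral_labeledBy_sub (hm j) (h1 j)]
    have : ∀ x, q.oddPart x * (sgn j.2 * g j.1 x) = sgn j.2 * (q.oddPart x * g j.1 x) :=
      fun x => by ring
    simp only [this, integral_const_mul, abs_mul]
    rcases hsgn j.2 with h | h <;> simpa [h] using hlt.le
  -- The factor `Fin 3` clears denominators: almost every seed fails on at least `2 * card ι + 1`
  -- triples, while failure probability 1/3 on `6 * card ι` triples allows only `2 * card ι` on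
  -- average.
  have hcount : ∀ᵐ ω ∂μ, ∃ J : Finset (ι × Bool × Fin 3), 2 * Fintype.card ι + 1 ≤ J.card ∧
      ∀ j ∈ J, ω ∈ S (j.1, j.2.1) := by
    filter_upwards [hfew] with ω hω
    set R := (A ω).queries O₀
    set B : Finset ι := Finset.univ.filter fun i => ∃ q ∈ R, i ∈ bad q
    have hBcard : (B.card : ℝ) ≤ R.length * K := by
      have hBsub : ∀ R : List (StatQuery d),
          ((Finset.univ.filter fun i => ∃ q ∈ R, i ∈ bad q).card : ℝ) ≤ R.length * K := by
        intro R
        induction R with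
        | nil => simp
        | cons q R ih =>
          have hsub : (Finset.univ.filter fun i => ∃ q' ∈ q :: R, i ∈ bad q') ⊆
              bad q ∪ Finset.univ.filter fun i => ∃ q' ∈ R, i ∈ bad q' := fun i hi => by
            simpa using hi
          have hle : ((bad q).card : ℝ) ≤ K := hq q _ fun i hi => by simpa [bad] using hi
          have hc : ((Finset.univ.filter fun i => ∃ q' ∈ q :: R, i ∈ bad q').card : ℝ) ≤
              (bad q).card + (Finset.univ.filter fun i => ∃ q' ∈ R, i ∈ bad q').card := by
            exact_mod_cast (Finset.card_le_card hsub).trans (Finset.card_union_le _ _)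
          rw [List.length_cons]; push_cast; linarith
      exact hBsub R
    have hB3 : 3 * B.card + 1 ≤ Fintype.card ι := by
      have : (3 : ℝ) * B.card < Fintype.card ι := by
        have hlen : (R.length : ℝ) ≤ T := by rw [SQAlgorithm.length_queries]; exact hω.le
        nlinarith [mul_le_mul_of_nonneg_right hlen hK]
      exact_mod_cast this
    have hfail : ∀ i ∉ B, ∃ b, ω ∈ S (i, b) := by
      intro i hi
      have hi' : ∀ q ∈ R, i ∉ bad q := by simpa [B] using hi
      have hrun : ∀ b, (A ω).run (O (i, b)) = (A ω).run O₀ := fun b =>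
        SQAlgorithm.run_congr _ fun q hqR => hgood q (i, b) (hi' q hqR)
      by_contra! hcon
      have ht := not_not.1 (hcon true)
      have hf := not_not.1 (hcon false)
      rw [hrun] at ht hf
      have hsum := zeroOneError_labeledBy_add_neg (hg i) (hg1 i) ((A ω).run O₀).measurable
        ((A ω).run O₀).eq_one_or
      have o1 := hopt i 1 (Or.inl rfl)
      have o2 := hopt i (-1) (Or.inr rfl)
      simp only [D, sgn, if_true, Bool.false_eq_true, if_false, one_mul, neg_one_mul]
        at ht hf o1 o2
      linarith
    choose! β hβ using hfail
    refine ⟨(Bᶜ ×ˢ (Finset.univ : Finset (Fin 3))).image fun x => (x.1, β x.1, x.2), ?_, ?_⟩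
    · rw [Finset.card_image_of_injective, Finset.card_product, Finset.card_compl, Finset.card_univ,
        Fintype.card_fin]
      · have := Finset.card_le_univ B
        omega
      · rintro ⟨i, k⟩ ⟨i', k'⟩ h
        simp only [Prod.mk.injEq] at h ⊢
        exact ⟨h.1, h.2.2⟩
    · intro j hj
      obtain ⟨x, hx, rfl⟩ := Finset.mem_image.1 hj
      exact hβ _ (Finset.mem_compl.1 (Finset.mem_product.1 hx).1)
  have hsum := natCast_le_sum_measure (μ := μ) (fun j : ι × Bool × Fin 3 => S (j.1, j.2.1)) _ hcount
  have hle : ∑ j : ι × Bool × Fin 3, μ (S (j.1, j.2.1)) ≤ ((2 * Fintype.card ι : ℕ) : ENNReal) := by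
    calc _ ≤ ∑ _j : ι × Bool × Fin 3, (1 / 3 : ENNReal) := Finset.sum_le_sum fun j _ => hS _
      _ = _ := by
        rw [Finset.sum_const, Finset.card_univ, Fintype.card_prod, Fintype.card_prod,
          Fintype.card_bool, Fintype.card_fin, nsmul_eq_mul,
          show Fintype.card ι * (2 * 3) = 2 * Fintype.card ι * 3 by ring, Nat.cast_mul _ 3, mul_assoc,
          Nat.cast_ofNat, ENNReal.mul_div_cancel (by simp) (by simp), mul_one]
  have := hsum.trans hle
  rw [Nat.cast_le] at this
  omega

/-! ### Choice of parameters. -/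

/-- A prime between `√d / 2` and `√d`. -/
lemma exists_prime_sq_le {d : ℕ} (hd : 4 ≤ d) :
    ∃ p : ℕ, p.Prime ∧ p ^ 2 ≤ d ∧ (d : ℝ) ^ (1 / 2 : ℝ) ≤ 2 * p := by
  have hs : 2 ≤ Nat.sqrt d := Nat.le_sqrt'.2 (by omega)
  -- Bertrand's postulate at half the integer square root.
  obtain ⟨p, hp, h1, h2⟩ := Nat.exists_prime_lt_and_le_two_mul (Nat.sqrt d / 2) (by omega)
  have hps : p ≤ Nat.sqrt d := by omega
  refine ⟨p, hp, (Nat.pow_le_pow_left hps 2).trans (Nat.sqrt_le' d), ?_⟩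
  rw [← Real.sqrt_eq_rpow, Real.sqrt_le_left (by positivity)]
  have h3 : d ≤ (2 * p) ^ 2 :=
    (Nat.lt_succ_sqrt' d).le.trans (Nat.pow_le_pow_left (by omega) 2)
  exact_mod_cast h3

theorem theorem1 :
    ∃ c : ℝ, 0 < c ∧
      ∀ d : ℕ, 1 ≤ d → ∀ ε : ℝ, (d : ℝ) ^ (-c) ≤ ε → ε < 1 / 2 →
        ∀ (Ω : Type*) [MeasurableSpace Ω] (μ : Measure Ω) [IsProbabilityMeasure μ]
          (A : Ω → SQAlgorithm d),
          AgnosticallyLearnsHalfspaces μ A ε ((d : ℝ) ^ (-(c / ε))) →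
          ∃ D : Measure (LabeledExample d), IsGaussianInstance D ∧
            ∃ O ∈ STAT D ((d : ℝ) ^ (-(c / ε))),
              0 < μ {ω | (d : ℝ) ^ (c / ε) ≤ ((A ω).numQueries O : ℝ)} := by
  refine ⟨1 / 40, by norm_num, fun d hd ε hε hε2 Ω _ μ _ A hA => ?_⟩
  set X : ℝ := (d : ℝ) with hX
  have hX1 : 1 ≤ X := Nat.one_le_cast.2 hd
  have hX0 : 0 < X := by linarith
  have hε0 : 0 < ε := (Real.rpow_pos_of_pos hX0 _).trans_le hε
  have hL : 1 / ε ≤ X ^ (1 / 40 : ℝ) := by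
    rw [Real.rpow_neg hX0.le] at hε
    rw [one_div]; exact inv_le_of_inv_le₀ (Real.rpow_pos_of_pos hX0 _) hε
  -- The assumptions on ε already force d ≥ 2^40, so numerical constants can be absorbed into small
  -- powers of `X`.
  have hL2 : 2 ≤ X ^ (1 / 40 : ℝ) := by
    refine le_trans ?_ hL
    rw [le_div_iff₀ hε0]; linarith
  have hXbig : (4 : ℝ) ≤ X := by
    have : X = (X ^ (1 / 40 : ℝ)) ^ 40 := by
      rw [← Real.rpow_natCast, ← Real.rpow_mul hX0.le]; norm_num
    rw [this]
    calc (4 : ℝ) ≤ 2 ^ 40 := by norm_num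
      _ ≤ _ := by gcongr
  obtain ⟨p, hp, hpd, hXp⟩ := exists_prime_sq_le (d := d) (by rw [hX] at hXbig; exact_mod_cast hXbig)
  have : Fact p.Prime := ⟨hp⟩
  have hp0 : (0 : ℝ) < p := by exact_mod_cast hp.pos
  -- `m` is the largest integer strictly below 1/(2ε). Strictness gives 1/2 - 1/(2m) + ε < 1/2, and
  -- `m + 1 ≤ 2 * m` gives 1/ε ≤ 4m.
  obtain ⟨m, hm0, hm1, hm2⟩ : ∃ m : ℕ, 0 < m ∧ (m : ℝ) < 1 / (2 * ε) ∧ 1 / (2 * ε) ≤ m + 1 := by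
    have h1 : (1 : ℝ) < 1 / (2 * ε) := by rw [lt_div_iff₀ (by positivity)]; linarith
    have h2 : 1 < ⌈1 / (2 * ε)⌉₊ := Nat.lt_ceil.2 (by exact_mod_cast h1)
    refine ⟨⌈1 / (2 * ε)⌉₊ - 1, by omega, Nat.lt_ceil.1 (by omega), ?_⟩
    have h3 := Nat.le_ceil (1 / (2 * ε))
    have h4 : ((⌈1 / (2 * ε)⌉₊ - 1 : ℕ) : ℝ) + 1 = ⌈1 / (2 * ε)⌉₊ := by
      exact_mod_cast Nat.sub_add_cancel h2.le
    linarith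
  have hm1' : (1 : ℝ) ≤ m := by exact_mod_cast hm0
  have hε_inv : 1 / (2 * ε) = 1 / ε / 2 := by field_simp
  rw [hε_inv] at hm2
  have hcε : (1 / 40 : ℝ) / ε ≤ m / 10 := by
    rw [div_eq_mul_one_div]; linarith
  have hmX : (m : ℝ) ≤ X ^ (1 / 40 : ℝ) / 2 := by rw [hε_inv] at hm1; linarith
  have hpow : ∀ k : ℕ, (2 : ℝ) ^ k ≤ X ^ ((k : ℝ) / 40) := fun k => by
    calc (2 : ℝ) ^ k ≤ (X ^ (1 / 40 : ℝ)) ^ k := by gcongr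
      _ = _ := by
        rw [← Real.rpow_natCast, ← Real.rpow_mul hX0.le]; congr 1; ring
  set τ := X ^ (-((1 / 40 : ℝ) / ε)) with hτ
  set T := X ^ ((1 / 40 : ℝ) / ε) with hT
  have hτ0 : 0 < τ := Real.rpow_pos_of_pos hX0 _
  have hT0 : 0 < T := Real.rpow_pos_of_pos hX0 _
  have hτT : τ = T⁻¹ := Real.rpow_neg hX0.le _
  have hTle : T ≤ X ^ ((m : ℝ) / 10) := Real.rpow_le_rpow_of_exponent_le hX1 hcε
  -- The exponent is 2/40 + 1/40 - 20/40, from 4 ≤ X^(2/40), 2m ≤ X^(1/40) and 2p ≥ X^(1/2).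
  set δ := X ^ (-(17 / 40) : ℝ) with hδ
  have hδ0 : 0 < δ := Real.rpow_pos_of_pos hX0 _
  have hδ1 : δ ≤ 1 := Real.rpow_le_one_of_one_le_of_nonpos hX1 (by norm_num)
  have hρ : 4 * ((m : ℝ) / p) ≤ δ := by
    have h4 := hpow 2
    calc 4 * ((m : ℝ) / p) ≤ 4 * ((X ^ (1 / 40 : ℝ) / 2) / (X ^ (1 / 2 : ℝ) / 2)) := by
          gcongr; linarith
      _ = 2 ^ 2 * (X ^ (1 / 40 : ℝ) / X ^ (1 / 2 : ℝ)) := by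
          have := (Real.rpow_pos_of_pos hX0 (1 / 2)).ne'
          field_simp; norm_num
      _ ≤ X ^ (((2 : ℕ) : ℝ) / 40) * (X ^ (1 / 40 : ℝ) / X ^ (1 / 2 : ℝ)) := by gcongr
      _ = δ := by
          rw [← Real.rpow_sub hX0, ← Real.rpow_add hX0, hδ]; norm_num
  have hδm : δ ^ m = X ^ (-(17 / 40) * m : ℝ) := by
    rw [hδ, ← Real.rpow_natCast, ← Real.rpow_mul hX0.le]
  -- With 8 ≤ X^(3/40), this needs 3/40 - 17m/40 ≤ -m/5, true for `m ≥ 1`.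
  have hη : 4 * δ ^ m ≤ τ ^ 2 / 2 := by
    have h8 := hpow 3
    have h1 : 8 * δ ^ m ≤ (X ^ ((m : ℝ) / 10))⁻¹ ^ 2 := by
      calc 8 * δ ^ m = 2 ^ 3 * X ^ (-(17 / 40) * m : ℝ) := by rw [hδm]; norm_num
        _ ≤ X ^ (((3 : ℕ) : ℝ) / 40) * X ^ (-(17 / 40) * m : ℝ) := by gcongr
        _ ≤ X ^ (-((m : ℝ) / 10) * (2 : ℕ)) := by
          rw [← Real.rpow_add hX0]
          refine Real.rpow_le_rpow_of_exponent_le hX1 ?_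
          push_cast; linarith
        _ = _ := by rw [Real.rpow_mul hX0.le, Real.rpow_natCast, Real.rpow_neg hX0.le]
    have h2 : (X ^ ((m : ℝ) / 10))⁻¹ ^ 2 ≤ τ ^ 2 := by rw [hτT]; gcongr
    linarith
  obtain ⟨f, hfm, hf1, hmom, t, ht⟩ := by
    have := nullSingletonClass_gaussianReal (μ := 0) (v := 1) one_ne_zero
    exact exists_moment_matching_sign (μ := gaussianReal 0 1) integrable_pow_gaussianReal hm0
  obtain ⟨V, hV, hVV⟩ := exists_nearly_orthogonal_family hpd m
  have hgm : ∀ i, Measurable fun x => f (inner ℝ (V i) x) := fun i => by fun_prop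
  -- Since the pairwise correlation is at most `τ ^ 2 / 2`, each query catches at most `2 / τ ^ 2 =
  -- 2 * T ^ 2` directions.
  refine exists_many_queries (g := fun i x => f (inner ℝ (V i) x)) (K := 2 * T ^ 2) hτ0.le
    (by positivity) hA hgm (fun i x => hf1 _) (fun i σ hσ => ?_) (fun q B hB => ?_) ?_
  · have h1 := optHalfspaceError_labeledBy_le hfm hf1 (hV i) hσ ht
    have h2 : ε < 1 / m / 2 := by
      rw [div_div, lt_div_iff₀ (by positivity)]
      rw [lt_div_iff₀ (by positivity)] at hm1
      linarith
    linarith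
  · have h1 := card_mul_le_one_of_correlated hgm (fun i x => hf1 _)
      (η := 4 * δ ^ m) (by positivity) hτ0.le (fun i j hij => ?_) q.measurable_oddPart
      q.abs_oddPart_le_one B hB
    · have h2 : (B.card : ℝ) * (τ ^ 2 / 2) ≤ 1 := by
        refine le_trans ?_ h1
        gcongr; linarith
      rw [hτT, inv_pow, inv_eq_one_div, div_div, mul_one_div, div_le_one (by positivity)] at h2
      linarith
    · obtain ⟨h2, h3⟩ := hVV i j hij
      have h4 : 4 * inner ℝ (V i) (V j) ≤ δ := le_trans (by gcongr) hρ
      refine (abs_integral_inner_mul_inner_le hfm hf1 hmom (hV i) (hV j) h2 (h4.trans hδ1)).trans ?_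
      gcongr
  -- The p^m directions outnumber 6T³: p ≥ X^(19/40), while T³ ≤ X^(12m/40) and the constant costs
  -- X^(3/40).
  · have h8 := hpow 3
    have hcard : (Fintype.card (Fin m → ZMod p) : ℝ) = (p : ℝ) ^ m := by simp [ZMod.card]
    rw [hcard]
    calc 3 * (T * (2 * T ^ 2)) = 6 * T ^ 3 := by ring
      _ < 2 ^ 3 * T ^ 3 := by gcongr; norm_num
      _ ≤ X ^ (((3 : ℕ) : ℝ) / 40) * (X ^ ((m : ℝ) / 10)) ^ 3 := by gcongr
      _ = X ^ ((3 : ℝ) / 40 + m / 10 * 3) := by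
        rw [← Real.rpow_natCast, ← Real.rpow_mul hX0.le, ← Real.rpow_add hX0]; norm_num
      _ ≤ X ^ ((19 / 40 : ℝ) * m) := Real.rpow_le_rpow_of_exponent_le hX1 (by linarith)
      _ = (X ^ (19 / 40 : ℝ)) ^ m := by rw [Real.rpow_mul hX0.le, Real.rpow_natCast]
      _ ≤ (p : ℝ) ^ m := by
        gcongr
        have h3 : X ^ (1 / 2 : ℝ) = X ^ (1 / 40 : ℝ) * X ^ (19 / 40 : ℝ) := by
          rw [← Real.rpow_add hX0]; norm_num
        have h4 : 0 < X ^ (19 / 40 : ℝ) := Real.rpow_pos_of_pos hX0 _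
        nlinarith
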